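/- Let $K$ be a finite subset of the closed unit disc in $\mathbb C$, let $\mathbb N=\{1,2,\dots\}$, and let $T$ be the shift $(Tx)_n=x_{n+1}$ on $K^{\mathbb N}$ (product topology). All measures on $K^{\mathbb N}$ considered are Borel probability measures. A point $x\in K^{\mathbb N}$ is generic for a $T$-invariant measure $\mu$ if $\frac1n\sum_{i=1}^n f(T^ix)\to\int f\,d\mu$ for every continuous $f:K^{\mathbb N}\to\mathbb C$. For $x,y\in K^{\mathbb N}$ put $$c_n(x,y)=\frac1n\sum_{i=1}^n x_i\overline{y_i}-\Bigl(\frac1n\sum_{i=1}^n x_i\Bigr)\Bigl(\frac1n\sum_{i=1}^n\overline{y_i}\Bigr);$$ $x$ and $y$ are weakly correlated if $\limsup_n|c_n(x,y)|>0$ and strongly correlated if $\liminf_n|c_n(x,y)|>0$. A joining of $T$-invariant measures $\mu$ and $\nu$ on $K^{\mathbb N}$ is a $T\times T$-invariant Borel probability measure $\xi$ on $K^{\mathbb N}\times K^{\mathbb N}$ with marginals $\mu$ and $\nu$; the measures $\mu$ and $\nu$ are correlated if $$\sup_{\xi}\Bigl|\int x_1\overline{y_1}\,d\xi(x,y)-\int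 x_1\,d\mu(x)\int\overline{y_1}\,d\nu(y)\Bigr|\neq0,$$ where $\xi$ ranges over all joinings of $\mu$ and $\nu$. **Theorem 2.5.** Let $x\in K^{\mathbb N}$ be generic for a $T$-invariant measure $\mu$ on $K^{\mathbb N}$. The following conditions are equivalent: 1. $x$ is weakly correlated to some point $y\in K^{\mathbb N}$ that is generic for an ergodic $T$-invariant measure on $K^{\mathbb N}$; 2. $x$ is strongly correlated to some point $y\in K^{\mathbb N}$ that is generic for an ergodic $T$-invariant measure on $K^{\mathbb N}$; 3. $\mu$ is correlated to some ergodic $T$-invariant measure on $K^{\mathbb N}$. -/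

import Mathlib

open MeasureTheory Filter Topology ComplexConjugate

namespace SeqCorr

/-! ### Correlation of complex sequences

Sequences are indexed by `ℕ`; the entry with index `0` is the first symbol (written with index `1`
when the positive integers are the index set), so `x_{[1,n]}` is `x 0, …, x (n - 1)`. -/

/-- Correlation of two blocks of complex numbers of the same length `n`. -/
noncomputable def blockCorr {n : ℕ} (A B : Fin n → ℂ) : ℂ :=
  (1 / (n : ℂ)) * ∑ i, A i * conj (B i) -
    ((1 / (n : ℂ)) * ∑ i, A i) * ((1 / (n : ℂ)) * ∑ i, conj (B i))

/-- The initial block of length `n` of a sequence. -/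
def initialBlock (x : ℕ → ℂ) (n : ℕ) : Fin n → ℂ := fun i => x i

/-- Weak correlation of two (bounded) complex sequences. -/
def WeaklyCorrelated (x y : ℕ → ℂ) : Prop :=
  0 < limsup (fun n : ℕ => ‖blockCorr (initialBlock x n) (initialBlock y n)‖) atTop

/-- Strong correlation of two (bounded) complex sequences. -/
def StronglyCorrelated (x y : ℕ → ℂ) : Prop :=
  0 < liminf (fun n : ℕ => ‖blockCorr (initialBlock x n) (initialBlock y n)‖) atTop

/-! ### Shift space, generic points -/

/-- The shift map on `A^ℕ`. -/
def shift {A : Type*} (x : ℕ → A) : ℕ → A := fun n => x (n + 1)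

/-- The point `x` of the topological dynamical system `(X, T)` is generic for the measure `μ`. -/
def IsGeneric {X : Type*} [TopologicalSpace X] [MeasurableSpace X]
    (T : X → X) (x : X) (μ : Measure X) : Prop :=
  ∀ f : X → ℂ, Continuous f →
    Tendsto (fun n : ℕ => (1 / (n : ℂ)) * ∑ i ∈ Finset.Icc 1 n, f (T^[i] x)) atTop
      (𝓝 (∫ z, f z ∂μ))

/-- `μ` is a `T`-invariant probability measure. -/
structure IsInvariantProb {X : Type*} [MeasurableSpace X] (T : X → X) (μ : Measure X) : Prop where
  prob : IsProbabilityMeasure μ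
  invariant : MeasurePreserving T μ μ

/-- `μ` is an ergodic (`T`-invariant) probability measure. -/
structure IsErgodicProb {X : Type*} [MeasurableSpace X] (T : X → X) (μ : Measure X) : Prop where
  prob : IsProbabilityMeasure μ
  ergodic : Ergodic T μ

/-! ### Joinings and correlation of shift-invariant measures -/

/-- `ξ` is a joining of the shift-invariant measures `μ` and `ν`: a probability measure on the
product, invariant under the product of the shifts, with marginals `μ` and `ν`. -/
structure IsJoining {A : Type*} [MeasurableSpace A] (μ ν : Measure (ℕ → A))
    (ξ : Measure ((ℕ → A) × (ℕ → A))) : Prop where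
  invariantProb : IsInvariantProb (Prod.map shift shift) ξ
  fst : ξ.map Prod.fst = μ
  snd : ξ.map Prod.snd = ν

/-- `∫ x₁ · conj y₁ dξ - ∫ x₁ dμ · ∫ conj y₁ dν`. -/
noncomputable def joiningCorr {K : Set ℂ} (μ ν : Measure (ℕ → K))
    (ξ : Measure ((ℕ → K) × (ℕ → K))) : ℂ :=
  (∫ p, (p.1 0 : ℂ) * conj (p.2 0 : ℂ) ∂ξ) -
    (∫ x, (x 0 : ℂ) ∂μ) * (∫ y, conj (y 0 : ℂ) ∂ν)

/-- The correlation of two shift-invariant measures: the supremum over all joinings. -/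
noncomputable def measureCorr {K : Set ℂ} (μ ν : Measure (ℕ → K)) : ℝ :=
  sSup {r : ℝ | ∃ ξ : Measure ((ℕ → K) × (ℕ → K)), IsJoining μ ν ξ ∧ r = ‖joiningCorr μ ν ξ‖}

/-- Two shift-invariant measures are correlated if their correlation is not zero. -/
def MeasuresCorrelated {K : Set ℂ} (μ ν : Measure (ℕ → K)) : Prop :=
  measureCorr μ ν ≠ 0

/-- The supremum defining the correlation is taken over a nonempty set: the product measure is a
joining. -/
theorem measureCorr_set_nonempty {K : Set ℂ} {μ ν : Measure (ℕ → K)}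
    (hμ : IsInvariantProb shift μ) (hν : IsInvariantProb shift ν) :
    {r : ℝ | ∃ ξ : Measure ((ℕ → K) × (ℕ → K)),
      IsJoining μ ν ξ ∧ r = ‖joiningCorr μ ν ξ‖}.Nonempty := by
  have := hμ.prob
  have := hν.prob
  refine ⟨_, μ.prod ν, ⟨⟨inferInstance, hμ.invariant.prod hν.invariant⟩, ?_, ?_⟩, rfl⟩
  · simp
  · simp

/-- The supremum defining the correlation is taken over a bounded set. -/
theorem measureCorr_set_bddAbove {K : Set ℂ} (hK : K ⊆ Metric.closedBall 0 1)
    {μ ν : Measure (ℕ → K)} (hμ : IsInvariantProb shift μ) (hν : IsInvariantProb shift ν) :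
    BddAbove {r : ℝ | ∃ ξ : Measure ((ℕ → K) × (ℕ → K)),
      IsJoining μ ν ξ ∧ r = ‖joiningCorr μ ν ξ‖} := by
  have hb : ∀ k : K, ‖(k : ℂ)‖ ≤ 1 := fun k => by simpa using hK k.2
  refine ⟨1 + 1 * 1, ?_⟩
  rintro r ⟨ξ, hξ, rfl⟩
  have := hμ.prob
  have := hν.prob
  have := hξ.invariantProb.prob
  have h1 : ‖∫ p : (ℕ → K) × (ℕ → K), (p.1 0 : ℂ) * conj (p.2 0 : ℂ) ∂ξ‖ ≤ 1 := by
    have := norm_integral_le_of_norm_le_const (μ := ξ) (C := 1)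
      (f := fun p : (ℕ → K) × (ℕ → K) => (p.1 0 : ℂ) * conj (p.2 0 : ℂ))
      (Eventually.of_forall fun p => by
        rw [norm_mul, RCLike.norm_conj]
        exact mul_le_one₀ (hb _) (norm_nonneg _) (hb _))
    simpa using this
  have h2 : ‖∫ x : ℕ → K, (x 0 : ℂ) ∂μ‖ ≤ 1 := by
    have := norm_integral_le_of_norm_le_const (μ := μ) (C := 1)
      (f := fun x : ℕ → K => (x 0 : ℂ)) (Eventually.of_forall fun x => hb _)
    simpa using this
  have h3 : ‖∫ y : ℕ → K, conj (y 0 : ℂ) ∂ν‖ ≤ 1 := by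
    have := norm_integral_le_of_norm_le_const (μ := ν) (C := 1)
      (f := fun y : ℕ → K => conj (y 0 : ℂ)) (Eventually.of_forall fun y => by
        rw [RCLike.norm_conj]
        exact hb _)
    simpa using this
  refine (norm_sub_le _ _).trans (add_le_add h1 ?_)
  rw [norm_mul]
  exact mul_le_mul h2 h3 (norm_nonneg _) zero_le_one

end SeqCorr

namespace SeqCorr

open scoped RealInnerProductSpace

/-! The same ergodic measure ν serves in all three conditions. Since the correlations of blocks are
bounded, strong correlation implies weak correlation.

Weakly correlated points give correlated measures by compactness. Take an ultrafilter finer than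
`atTop` on which |c_n| stays above some δ > 0. Along it the empirical measures of (x, y) converge
weakly to a probability measure ξ. This limit is shift invariant, its marginals are μ and ν because
x and y are generic, and its correlation is the limit of c_n, of modulus at least δ.

Conversely, a nonzero supremum yields a joining ξ with nonzero correlation. By Kamae's lifting
theorem (`exists_isGeneric_lift`), x extends to a pair (x, y) generic for ξ. Then y is generic for ν
and c_n converges to a nonzero number, which is strong correlation.

The lifting theorem is proved by an approachability argument in the style of Blackwell. All word
frequencies of a pair are encoded in one Hilbert space valued function `wordMap`, with mean t under
ξ; it suffices that its orbit averages along (x, y) tend to t. The sequence y is built in stages. If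
w is the deviation of the orbit sum from a·t at time a, the next stretch of y, of length n ≤ εa, is
chosen so that its own deviation has inner product at most εn‖w‖ with w. Then ‖w‖² grows by at most
a constant times ε times the growth of a², and ε → 0 forces ‖w‖ = o(a).

Such a stretch exists (`IsTame.exists_continuation`) because the conditional expectations of L-block
sums under ξ, given the L-word of the first sequence, average to L·t along the generic point x. In
any prescribed direction some actual second sequence does at least as well as the conditional
expectation, up to a bounded error; such answers are concatenated. -/

theorem shift_iterate {A : Type*} (x : ℕ → A) (n : ℕ) :
    shift^[n] x = fun i => x (i + n) := by
  induction n generalizing x with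
  | zero => rfl
  | succ n ih =>
    rw [Function.iterate_succ_apply, ih]
    funext i
    exact congrArg x (by omega)

theorem shift_iterate_apply {A : Type*} (x : ℕ → A) (n i : ℕ) :
    (shift^[n] x) i = x (i + n) := by
  rw [shift_iterate]

/-! ### Orbit sums of functions with exponentially decaying memory -/

/-- The sum of `f` along the orbit segment of length `n` of the pair `(x, y)`. -/
def orbitSum {A B E : Type*} [AddCommMonoid E] (f : (ℕ → A) × (ℕ → B) → E)
    (x : ℕ → A) (y : ℕ → B) (n : ℕ) : E :=
  ∑ i ∈ Finset.range n, f (shift^[i] x, shift^[i] y)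

/-- A bounded function on pairs of sequences whose dependence on the coordinates beyond the first
`k` decays like `2⁻ᵏ`. -/
structure IsTame {A B E : Type*} [NormedAddCommGroup E] (f : (ℕ → A) × (ℕ → B) → E)
    (C : ℝ) : Prop where
  bound : ∀ u, ‖f u‖ ≤ C
  close : ∀ (k : ℕ) (x x' : ℕ → A) (y y' : ℕ → B), (∀ i < k, x i = x' i) →
    (∀ i < k, y i = y' i) → ‖f (x, y) - f (x', y')‖ ≤ C * (1 / 2) ^ k

theorem orbitSum_add {A B E : Type*} [AddCommMonoid E] (f : (ℕ → A) × (ℕ → B) → E)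
    (x : ℕ → A) (y : ℕ → B) (m n : ℕ) :
    orbitSum f x y (m + n) = orbitSum f x y m + orbitSum f (shift^[m] x) (shift^[m] y) n := by
  simp only [orbitSum, Finset.sum_range_add]
  congr 1
  refine Finset.sum_congr rfl fun i _ => ?_
  simp only [← Function.iterate_add_apply, add_comm]

theorem sum_half_pow_sub_le_one (n : ℕ) :
    ∑ i ∈ Finset.range n, (1 / 2 : ℝ) ^ (n - i) ≤ 1 := by
  have h : ∑ i ∈ Finset.range n, (1 / 2 : ℝ) ^ (n - i) = 1 - (1 / 2) ^ n := by
    induction n with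
    | zero => simp
    | succ n ih =>
      rw [Finset.sum_range_succ]
      have : ∑ i ∈ Finset.range n, (1 / 2 : ℝ) ^ (n + 1 - i)
          = (1 / 2) * ∑ i ∈ Finset.range n, (1 / 2 : ℝ) ^ (n - i) := by
        rw [Finset.mul_sum]
        refine Finset.sum_congr rfl fun i hi => ?_
        rw [Finset.mem_range] at hi
        rw [Nat.succ_sub hi.le, pow_succ, mul_comm]
      rw [this, ih]
      simp [pow_succ]
      ring
  rw [h]
  have : (0 : ℝ) ≤ (1 / 2) ^ n := by positivity
  linarith

section

variable {A B E : Type*} [NormedAddCommGroup E] {f : (ℕ → A) × (ℕ → B) → E} {C : ℝ}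

theorem IsTame.norm_orbitSum_le (hf : IsTame f C) (x : ℕ → A) (y : ℕ → B) (n : ℕ) :
    ‖orbitSum f x y n‖ ≤ C * n := by
  refine (norm_sum_le_of_le _ fun i _ => hf.bound _).trans ?_
  simp [mul_comm]

/-- At time i the two orbits still agree on n - i coordinates, so the errors form a geometric
series. The bound does not depend on n, so cutting and pasting costs only C per seam. -/
theorem IsTame.norm_orbitSum_sub_le (hf : IsTame f C) (hC : 0 ≤ C) {x x' : ℕ → A} {y y' : ℕ → B}
    {n : ℕ} (hx : ∀ i < n, x i = x' i) (hy : ∀ i < n, y i = y' i) :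
    ‖orbitSum f x y n - orbitSum f x' y' n‖ ≤ C := by
  rw [orbitSum, orbitSum, ← Finset.sum_sub_distrib]
  calc _ ≤ ∑ i ∈ Finset.range n, C * (1 / 2) ^ (n - i) := by
        refine norm_sum_le_of_le _ fun i hi => ?_
        refine hf.close _ _ _ _ _ (fun j hj => ?_) fun j hj => ?_
        · rw [shift_iterate_apply, shift_iterate_apply]
          exact hx _ (by omega)
        · rw [shift_iterate_apply, shift_iterate_apply]
          exact hy _ (by omega)
    _ = C * ∑ i ∈ Finset.range n, (1 / 2 : ℝ) ^ (n - i) := by rw [Finset.mul_sum]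
    _ ≤ C * 1 := by gcongr; exact sum_half_pow_sub_le_one n
    _ = C := mul_one C

end

/-! ### Splicing and concatenating blocks -/

/-- Follow `y` before time `a` and `z`, started at its beginning, from time `a` on. -/
def splice {B : Type*} (a : ℕ) (y z : ℕ → B) : ℕ → B := fun i => if i < a then y i else z (i - a)

theorem splice_of_lt {B : Type*} {a i : ℕ} (y z : ℕ → B) (h : i < a) : splice a y z i = y i :=
  if_pos h

theorem shift_iterate_splice {B : Type*} (a : ℕ) (y z : ℕ → B) :
    shift^[a] (splice a y z) = z := by
  funext i
  simp [shift_iterate_apply, splice]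

/-- Concatenation of the initial blocks of length `L` of the sequences `z 0`, `z 1`, …. -/
def concat {B : Type*} (L : ℕ) (z : ℕ → ℕ → B) : ℕ → B := fun i => z (i / L) (i % L)

theorem shift_iterate_concat {B : Type*} {L : ℕ} (z : ℕ → ℕ → B) (k : ℕ) {i : ℕ} (hi : i < L) :
    (shift^[k * L] (concat L z)) i = z k i := by
  rw [shift_iterate_apply, concat, Nat.add_mul_mod_self_right, Nat.mod_eq_of_lt hi,
    Nat.add_mul_div_right _ _ (by omega), Nat.div_eq_of_lt hi, zero_add]

section

variable {A B E : Type*} [NormedAddCommGroup E] [InnerProductSpace ℝ E]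
  {f : (ℕ → A) × (ℕ → B) → E} {C : ℝ}

theorem inner_le_inner_add {φ u v : E} {c : ℝ} (h : ‖u - v‖ ≤ c) :
    ⟪φ, u⟫ ≤ ⟪φ, v⟫ + c * ‖φ‖ := by
  have h1 : ⟪φ, u - v⟫ ≤ ‖φ‖ * ‖u - v‖ := real_inner_le_norm _ _
  rw [inner_sub_right] at h1
  nlinarith [norm_nonneg φ]

theorem sum_range_mul_eq (h : ℕ → ℝ) (K L : ℕ) :
    ∑ p ∈ Finset.range (K * L), h p
      = ∑ r ∈ Finset.range L, ∑ k ∈ Finset.range K, h (r + k * L) := by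
  induction K with
  | zero => simp
  | succ K ih =>
    simp only [Finset.sum_range_succ, Finset.sum_add_distrib, ← ih, Nat.succ_mul,
      Finset.sum_range_add]
    congr 1
    exact Finset.sum_congr rfl fun r _ => by rw [add_comm]

/-- The positions below K * L split into L residue classes, and some class has at least the average
sum. This turns an average over all positions into one over disjoint blocks. -/
theorem exists_phase (h : ℕ → ℝ) (K : ℕ) {L : ℕ} (hL : 0 < L) :
    ∃ r < L, (1 / (L : ℝ)) * ∑ p ∈ Finset.range (K * L), h p
      ≤ ∑ k ∈ Finset.range K, h (r + k * L) := by
  by_contra! hcon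
  have h1 := Finset.sum_lt_sum_of_nonempty (s := Finset.range L) ⟨0, by simpa using hL⟩
    fun r hr => hcon r (Finset.mem_range.1 hr)
  rw [← sum_range_mul_eq] at h1
  have : (L : ℝ) ≠ 0 := by positivity
  simp only [Finset.sum_const, Finset.card_range, nsmul_eq_mul] at h1
  rw [← mul_assoc, mul_one_div_cancel this, one_mul] at h1
  exact lt_irrefl _ h1

/-- Each block agrees with its prescribed answer for L symbols; whatever follows it changes its
orbit sum by at most C. -/
theorem IsTame.inner_orbitSum_concat (hf : IsTame f C) (hC : 0 ≤ C) (x : ℕ → A) (φ : E) {L : ℕ}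
    (z : ℕ → ℕ → B) (K : ℕ) :
    ∑ k ∈ Finset.range K, (⟪φ, orbitSum f (shift^[k * L] x) (z k) L⟫ - C * ‖φ‖)
      ≤ ⟪φ, orbitSum f x (concat L z) (K * L)⟫ := by
  induction K with
  | zero => simp [orbitSum]
  | succ K ih =>
    rw [Finset.sum_range_succ, Nat.succ_mul, orbitSum_add, inner_add_right]
    refine add_le_add ih ?_
    rw [sub_le_iff_le_add]
    refine inner_le_inner_add (hf.norm_orbitSum_sub_le hC (fun _ _ => rfl) fun i hi => ?_)
    rw [shift_iterate_concat z K hi]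

/-- If every block of length `L` can be answered almost as well as a function `G` of the position
demands, then so can long blocks, on average over the positions. -/
theorem IsTame.exists_inner_orbitSum_ge [Nonempty B] (hf : IsTame f C) (hC : 0 ≤ C) (x : ℕ → A)
    (φ : E) {L : ℕ} (hL : 0 < L) (G : ℕ → E)
    (hG : ∀ p, ∃ z : ℕ → B, ⟪φ, G p⟫ - C * ‖φ‖ ≤ ⟪φ, orbitSum f (shift^[p] x) z L⟫) (K : ℕ) :
    ∃ z : ℕ → B, (1 / (L : ℝ)) * ⟪φ, ∑ p ∈ Finset.range (K * L), G p⟫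
      - (2 * K * C + L * C) * ‖φ‖ ≤ ⟪φ, orbitSum f x z (K * L + L)⟫ := by
  choose z hz using hG
  obtain ⟨r, hr, hr'⟩ := exists_phase (fun p => ⟪φ, G p⟫) K hL
  obtain ⟨b⟩ := ‹Nonempty B›
  -- The answers start at the good phase r. The r symbols before them and the L - r symbols after
  -- the K blocks are uncontrolled and cost at most L * C in total; each block loses C to `hG` and C
  -- to its seam.
  refine ⟨splice r (fun _ => b) (concat L fun k => z (r + k * L)), ?_⟩
  rw [inner_sum]
  have hsplit : K * L + L = r + (K * L + (L - r)) := by omega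
  rw [hsplit, orbitSum_add, orbitSum_add, inner_add_right, inner_add_right, shift_iterate_splice]
  set u := orbitSum f x (splice r (fun _ => b) (concat L fun k => z (r + k * L))) r
  set v := orbitSum f (shift^[K * L] (shift^[r] x))
    (shift^[K * L] (concat L fun k => z (r + k * L))) (L - r)
  have hu : -(C * r * ‖φ‖) ≤ ⟪φ, u⟫ := by
    have h1 := neg_le_of_abs_le (abs_real_inner_le_norm φ u)
    have h2 : ‖u‖ ≤ C * r := hf.norm_orbitSum_le _ _ _
    nlinarith [norm_nonneg φ]
  have hv : -(C * (L - r) * ‖φ‖) ≤ ⟪φ, v⟫ := by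
    have h1 := neg_le_of_abs_le (abs_real_inner_le_norm φ v)
    have h2 : ‖v‖ ≤ C * (L - r : ℕ) := hf.norm_orbitSum_le _ _ _
    rw [Nat.cast_sub hr.le] at h2
    nlinarith [norm_nonneg φ]
  have hw := hf.inner_orbitSum_concat hC (shift^[r] x) φ (L := L) (fun k => z (r + k * L)) K
  have hsum : ∑ k ∈ Finset.range K, (⟪φ, G (r + k * L)⟫ - C * ‖φ‖ - C * ‖φ‖) ≤
      ∑ k ∈ Finset.range K, (⟪φ, orbitSum f (shift^[k * L] (shift^[r] x)) (z (r + k * L)) L⟫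
        - C * ‖φ‖) := by
    refine Finset.sum_le_sum fun k _ => ?_
    have := hz (r + k * L)
    rw [add_comm r, Function.iterate_add_apply] at this
    rw [add_comm r]
    linarith
  simp only [Finset.sum_sub_distrib, Finset.sum_const, Finset.card_range, nsmul_eq_mul]
    at hsum hw hr'
  nlinarith
end

/-! ### Averages along generic orbits and word frequencies -/

theorem sum_Icc_one_eq_sum_range {E : Type*} [AddCommMonoid E] (h : ℕ → E) (n : ℕ) :
    ∑ i ∈ Finset.Icc 1 n, h i = ∑ i ∈ Finset.range n, h (i + 1) := by
  rw [Finset.range_eq_Ico, Finset.sum_Ico_add' h 0 n 1]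
  rfl

/-- The averages over `[1, n]` and over `[0, n - 1]` of a bounded sequence are asymptotically the
same. -/
theorem tendsto_average_Icc_sub_range {h : ℕ → ℂ} {C : ℝ} (hh : ∀ i, ‖h i‖ ≤ C) :
    Tendsto (fun n : ℕ => (1 / (n : ℂ)) * ∑ i ∈ Finset.Icc 1 n, h i
      - (1 / (n : ℂ)) * ∑ i ∈ Finset.range n, h i) atTop (𝓝 0) := by
  refine squeeze_zero_norm (a := fun n : ℕ => (1 / (n : ℝ)) * (C + C)) (fun n => ?_) ?_
  · rw [← mul_sub, sum_Icc_one_eq_sum_range, ← Finset.sum_sub_distrib, Finset.sum_range_sub,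
      norm_mul]
    have h1 : ‖(1 / (n : ℂ))‖ = 1 / (n : ℝ) := by simp
    rw [h1]
    gcongr
    exact (norm_sub_le _ _).trans (add_le_add (hh _) (hh _))
  · simpa using tendsto_one_div_atTop_nhds_zero_nat.mul_const (C + C)

/-- Genericity starts the average at T x, whereas initial blocks start at x itself; a continuous
function on a compact space is bounded, so the difference vanishes. -/
theorem IsGeneric.tendsto_range {X : Type*} [TopologicalSpace X] [CompactSpace X]
    [MeasurableSpace X] {T : X → X} {x : X} {μ : Measure X} (hx : IsGeneric T x μ) {f : X → ℂ}
    (hf : Continuous f) :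
    Tendsto (fun n : ℕ => (1 / (n : ℂ)) * ∑ i ∈ Finset.range n, f (T^[i] x)) atTop
      (𝓝 (∫ z, f z ∂μ)) := by
  obtain ⟨C, hC⟩ := isCompact_univ.exists_bound_of_continuousOn hf.continuousOn
  have h1 := tendsto_average_Icc_sub_range (h := fun i => f (T^[i] x)) fun i => hC _ trivial
  simpa using (hx f hf).sub h1

theorem isGeneric_of_tendsto_range {X : Type*} [TopologicalSpace X] [CompactSpace X]
    [MeasurableSpace X] {T : X → X} {x : X} {μ : Measure X}
    (hx : ∀ f : X → ℂ, Continuous f →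
      Tendsto (fun n : ℕ => (1 / (n : ℂ)) * ∑ i ∈ Finset.range n, f (T^[i] x)) atTop
        (𝓝 (∫ z, f z ∂μ))) : IsGeneric T x μ := by
  intro f hf
  obtain ⟨C, hC⟩ := isCompact_univ.exists_bound_of_continuousOn hf.continuousOn
  have h1 := tendsto_average_Icc_sub_range (h := fun i => f (T^[i] x)) fun i => hC _ trivial
  simpa using (hx f hf).add h1

theorem prodMap_shift_iterate {A B : Type*} (i : ℕ) (u : (ℕ → A) × (ℕ → B)) :
    (Prod.map shift shift)^[i] u = (shift^[i] u.1, shift^[i] u.2) := by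
  rw [Prod.map_iterate]
  rfl

/-- A sublinear bound on partial sums passes to sums over shifted segments. -/
theorem norm_sum_shifted_le {E : Type*} [NormedAddCommGroup E] {H : ℕ → E} {δ : ℝ} {N : ℕ}
    (hN : ∀ n ≥ N, ‖∑ p ∈ Finset.range n, H p‖ ≤ δ * n) {a : ℕ} (ha : N ≤ a) (m : ℕ) :
    ‖∑ p ∈ Finset.range m, H (p + a)‖ ≤ δ * (2 * a + m) := by
  have h1 : ∑ p ∈ Finset.range m, H (p + a)
      = ∑ p ∈ Finset.range (a + m), H p - ∑ p ∈ Finset.range a, H p := by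
    rw [Finset.sum_range_add, add_sub_cancel_left]
    exact Finset.sum_congr rfl fun p _ => by rw [add_comm]
  rw [h1]
  refine (norm_sub_le _ _).trans ((add_le_add (hN (a + m) (by omega)) (hN a ha)).trans ?_)
  push_cast
  linarith

/-- The initial word of length `L` of a sequence. -/
def word {A : Type*} (L : ℕ) (x : ℕ → A) : Fin L → A := fun i => x i

theorem word_eq_iff {A : Type*} {L : ℕ} {x y : ℕ → A} :
    word L x = word L y ↔ ∀ i < L, x i = y i :=
  ⟨fun h i hi => congrFun h ⟨i, hi⟩, fun h => funext fun i => h i i.2⟩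

section

variable {A : Type*} [TopologicalSpace A]

theorem continuous_word (L : ℕ) : Continuous (word L : (ℕ → A) → Fin L → A) := by
  unfold word
  fun_prop

theorem continuous_shift : Continuous (shift : (ℕ → A) → ℕ → A) := by
  unfold shift
  fun_prop

theorem isClopen_word_eq [DiscreteTopology A] (L : ℕ) (w : Fin L → A) :
    IsClopen {x : ℕ → A | word L x = w} :=
  (isClopen_discrete {w}).preimage (continuous_word L)

/-- Cylinders are clopen, so their indicators are continuous test functions, and `g (word L ·)` is a
finite combination of them with vector coefficients. -/
theorem IsGeneric.tendsto_word [Fintype A] [DiscreteTopology A] [MeasurableSpace A]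
    [OpensMeasurableSpace (ℕ → A)] {μ : Measure (ℕ → A)} {x : ℕ → A} (hx : IsGeneric shift x μ)
    {E : Type*} [NormedAddCommGroup E] [NormedSpace ℝ E] (L : ℕ) (g : (Fin L → A) → E) :
    Tendsto (fun n : ℕ => (1 / (n : ℝ)) • ∑ p ∈ Finset.range n, g (word L (shift^[p] x))) atTop
      (𝓝 (∑ w, μ.real {x | word L x = w} • g w)) := by
  classical
  have h1 : ∀ w : Fin L → A, Tendsto (fun n : ℕ => (1 / (n : ℝ)) *
      ∑ p ∈ Finset.range n, if word L (shift^[p] x) = w then (1 : ℝ) else 0) atTop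
      (𝓝 (μ.real {x | word L x = w})) := by
    intro w
    have hc := isClopen_word_eq L w
    have hcont : Continuous ({x : ℕ → A | word L x = w}.indicator fun _ => (1 : ℂ)) :=
      continuous_const.indicator (by simp [hc.frontier_eq])
    have h2 := hx.tendsto_range hcont
    rw [integral_indicator hc.isOpen.measurableSet] at h2
    have h3 := (Complex.continuous_re.tendsto _).comp h2
    convert h3 using 2
    · simp only [Function.comp, Set.indicator_apply, Set.mem_ofPred_eq]
      rename_i n
      rw [← Complex.ofReal_re ((1 / (n : ℝ)) * _)]
      push_cast
      simp only [apply_ite ((↑) : ℝ → ℂ), Complex.ofReal_one, Complex.ofReal_zero]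
    · simp
  have h2 := tendsto_finsetSum Finset.univ fun w _ => (h1 w).smul_const (g w)
  refine h2.congr fun n => ?_
  simp only [mul_smul, Finset.sum_smul, ite_smul, one_smul, zero_smul, ← Finset.smul_sum]
  rw [Finset.sum_comm]
  simp

end

section

variable {A B E : Type*} [TopologicalSpace A] [DiscreteTopology A]
  [TopologicalSpace B] [DiscreteTopology B] [NormedAddCommGroup E]
  {f : (ℕ → A) × (ℕ → B) → E} {C : ℝ}

theorem IsTame.continuous (hf : IsTame f C) : Continuous f := by
  rw [continuous_iff_continuousAt]
  rintro ⟨x, y⟩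
  have hlim : Tendsto (fun k : ℕ => C * (1 / 2 : ℝ) ^ k) atTop (𝓝 0) := by
    simpa using (tendsto_pow_atTop_nhds_zero_of_lt_one (r := (1 / 2 : ℝ)) (by norm_num)
      (by norm_num)).const_mul C
  rw [ContinuousAt, Metric.tendsto_nhds]
  intro ε hε
  obtain ⟨k, hk⟩ := (hlim.eventually (gt_mem_nhds hε)).exists
  have h1 : {u : ℕ → A | word k u = word k x} ×ˢ {u : ℕ → B | word k u = word k y} ∈ 𝓝 (x, y) :=
    prod_mem_nhds ((isClopen_word_eq k _).isOpen.mem_nhds rfl)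
      ((isClopen_word_eq k _).isOpen.mem_nhds rfl)
  filter_upwards [h1] with u hu
  rw [dist_eq_norm]
  exact (hf.close k _ _ _ _ (word_eq_iff.1 hu.1) (word_eq_iff.1 hu.2)).trans_lt hk

end

/-! ### Conditional expectations and compensating continuations -/

section

variable {A B E : Type*} [TopologicalSpace A] [DiscreteTopology A] [Fintype A]
  [MeasurableSpace A] [BorelSpace A]
  [TopologicalSpace B] [DiscreteTopology B] [Finite B] [MeasurableSpace B] [BorelSpace B]
  [NormedAddCommGroup E] [InnerProductSpace ℝ E]
  {f : (ℕ → A) × (ℕ → B) → E} {C : ℝ}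

theorem integrable_of_continuous_prod {F : Type*} [NormedAddCommGroup F]
    {h : (ℕ → A) × (ℕ → B) → F} (hh : Continuous h) (ξ : Measure ((ℕ → A) × (ℕ → B)))
    [IsFiniteMeasure ξ] : Integrable h ξ := by
  have : Countable A := Finite.to_countable
  have : Countable B := Finite.to_countable
  exact hh.integrable_of_hasCompactSupport (HasCompactSupport.of_compactSpace h)

theorem IsTame.integral_orbitSum (hf : IsTame f C) (ξ : Measure ((ℕ → A) × (ℕ → B)))
    [IsProbabilityMeasure ξ] (hξ : MeasurePreserving (Prod.map shift shift) ξ ξ) (L : ℕ) :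
    ∫ u, orbitSum f u.1 u.2 L ∂ξ = (L : ℝ) • ∫ u, f u ∂ξ := by
  have h1 : ∀ i, ∫ u : (ℕ → A) × (ℕ → B), f (shift^[i] u.1, shift^[i] u.2) ∂ξ = ∫ u, f u ∂ξ := by
    intro i
    have h2 := hξ.iterate i
    have : Countable A := Finite.to_countable
    have : Countable B := Finite.to_countable
    have h3 := integral_map h2.measurable.aemeasurable
      (hf.continuous.aestronglyMeasurable (μ := ξ.map (Prod.map shift shift)^[i]))
    rw [h2.map_eq] at h3
    rw [h3]
    simp only [prodMap_shift_iterate]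
  have hcont := hf.continuous
  simp only [orbitSum]
  rw [integral_finsetSum]
  · simp [h1, Nat.cast_smul_eq_nsmul ℝ]
  · intro i _
    refine integrable_of_continuous_prod ?_ ξ
    exact hcont.comp (((continuous_shift.iterate i).comp continuous_fst).prodMk
      ((continuous_shift.iterate i).comp continuous_snd))

/-- Conditioning on the initial word of the first sequence. -/
theorem IsTame.exists_conditional_target [CompleteSpace E] [Nonempty A] [Nonempty B]
    (hf : IsTame f C) (hC : 0 ≤ C)
    (ξ : Measure ((ℕ → A) × (ℕ → B))) [IsProbabilityMeasure ξ]
    (hξ : MeasurePreserving (Prod.map shift shift) ξ ξ) (L : ℕ) :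
    ∃ g : (Fin L → A) → E,
      ∑ w, (ξ.map Prod.fst).real {x | word L x = w} • g w = (L : ℝ) • ∫ u, f u ∂ξ ∧
      ∀ (x : ℕ → A) (φ : E), ∃ z : ℕ → B,
        ⟪φ, g (word L x)⟫ - C * ‖φ‖ ≤ ⟪φ, orbitSum f x z L⟫ := by
  classical
  have : Countable A := Finite.to_countable
  have : Countable B := Finite.to_countable
  obtain ⟨a⟩ := ‹Nonempty A›
  obtain ⟨b⟩ := ‹Nonempty B›
  let cyl : (Fin L → A) → Set ((ℕ → A) × (ℕ → B)) := fun w => {u | word L u.1 = w}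
  let ext : (Fin L → A) → ℕ → A := fun w i => if h : i < L then w ⟨i, h⟩ else a
  have hext : ∀ w, word L (ext w) = w := fun w => by
    funext i
    simp [word, ext]
  have hcyl : ∀ w, MeasurableSet (cyl w) := fun w =>
    ((isClopen_word_eq L w).preimage continuous_fst).isOpen.measurableSet
  have hcont : Continuous fun u : (ℕ → A) × (ℕ → B) => orbitSum f u.1 u.2 L := by
    unfold orbitSum
    refine continuous_finsetSum _ fun i _ => hf.continuous.comp ?_
    exact ((continuous_shift.iterate i).comp continuous_fst).prodMk
      ((continuous_shift.iterate i).comp continuous_snd)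
  have hint := integrable_of_continuous_prod hcont ξ
  -- The inequality below is required for every x, including those whose initial word is a null
  -- cylinder; there an actual orbit sum replaces the undefined conditional mean.
  let g : (Fin L → A) → E := fun w =>
    if ξ (cyl w) = 0 then orbitSum f (ext w) (fun _ => b) L
    else ⨍ u in cyl w, orbitSum f u.1 u.2 L ∂ξ
  refine ⟨g, ?_, fun x φ => ?_⟩
  · have h1 : ∀ w, (ξ.map Prod.fst).real {x | word L x = w} • g w
        = ∫ u in cyl w, orbitSum f u.1 u.2 L ∂ξ := by
      intro w
      rw [map_measureReal_apply measurable_fst (isClopen_word_eq L w).isOpen.measurableSet]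
      change ξ.real (cyl w) • g w = _
      by_cases h0 : ξ (cyl w) = 0
      · rw [Measure.real, h0, setIntegral_measure_zero _ h0]
        simp
      · simp only [g, if_neg h0]
        exact measure_smul_setAverage _ (measure_ne_top _ _)
    rw [← hf.integral_orbitSum ξ hξ L, Finset.sum_congr rfl fun w _ => h1 w,
      ← integral_iUnion_fintype hcyl]
    · have : ⋃ w, cyl w = Set.univ := Set.eq_univ_of_forall fun u =>
        Set.mem_iUnion.2 ⟨word L u.1, rfl⟩
      rw [this, setIntegral_univ]
    · intro w w' hne
      refine Set.disjoint_left.2 fun u hu hu' => hne ?_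
      exact hu.symm.trans hu'
    · exact fun w => hint.integrableOn
  · by_cases h0 : ξ (cyl (word L x)) = 0
    · refine ⟨fun _ => b, ?_⟩
      simp only [g, if_pos h0]
      rw [sub_le_iff_le_add]
      exact inner_le_inner_add (hf.norm_orbitSum_sub_le hC (word_eq_iff.1 (hext _))
        fun _ _ => rfl)
    · have hint' : IntegrableOn (fun u : (ℕ → A) × (ℕ → B) => ⟪φ, orbitSum f u.1 u.2 L⟫)
          (cyl (word L x)) ξ := (hint.const_inner φ).integrableOn
      -- Some point of the cylinder does at least as well as the mean. Its first sequence shares L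
      -- symbols with x, so replacing it by x costs at most C.
      obtain ⟨u, hu, hle⟩ := exists_setAverage_le h0 (measure_ne_top _ _) hint'
      refine ⟨u.2, ?_⟩
      have h2 : ⟪φ, g (word L x)⟫
          = ⨍ u in cyl (word L x), ⟪φ, orbitSum f u.1 u.2 L⟫ ∂ξ := by
        simp only [g, if_neg h0]
        rw [setAverage_eq, setAverage_eq, inner_smul_right, smul_eq_mul,
          integral_inner hint.integrableOn]
      rw [h2, sub_le_iff_le_add]
      exact hle.trans (inner_le_inner_add (hf.norm_orbitSum_sub_le hC (word_eq_iff.1 hu)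
        fun _ _ => rfl))

/-- Late enough, a short continuation of the second sequence can be found that compensates, up to
a small error, a given deviation. -/
theorem IsTame.exists_continuation [CompleteSpace E] [Nonempty A] [Nonempty B]
    (hf : IsTame f C) (hC : 0 < C)
    (ξ : Measure ((ℕ → A) × (ℕ → B))) [IsProbabilityMeasure ξ]
    (hξ : MeasurePreserving (Prod.map shift shift) ξ ξ) {x : ℕ → A}
    (hx : IsGeneric shift x (ξ.map Prod.fst)) {ε : ℝ} (hε : 0 < ε) :
    ∃ a₀ : ℕ, ∀ a ≥ a₀, ∀ φ : E, ∃ (n : ℕ) (z : ℕ → B), 0 < n ∧ (n : ℝ) ≤ ε * a ∧ C ≤ ε * n ∧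
      -(ε * n * ‖φ‖) ≤ ⟪φ, orbitSum f (shift^[a] x) z n - (n : ℝ) • ∫ u, f u ∂ξ⟫ := by
  have : Countable A := Finite.to_countable
  -- Each block of length L loses 2C; this choice makes the loss at most a quarter of ε * L.
  obtain ⟨L, hL⟩ := exists_nat_ge (8 * C / ε + 1)
  have hL0 : (0 : ℝ) < L := lt_of_lt_of_le (by positivity) hL
  have hLpos : 0 < L := by exact_mod_cast hL0
  have hL8 : 8 * C ≤ ε * L := by
    have : 8 * C / ε ≤ L := by linarith
    rwa [div_le_iff₀' hε] at this
  obtain ⟨g, hg, hgz⟩ := hf.exists_conditional_target hC.le ξ hξ L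
  set t := ∫ u, f u ∂ξ with ht
  have htC : ‖t‖ ≤ C := by
    simpa using norm_integral_le_of_norm_le_const (μ := ξ) (Eventually.of_forall hf.bound)
  -- Below, a ≤ 2n/ε and K * L ≤ n, so δ * (2a + K * L) is at most L * (ε * n / 4).
  set δ : ℝ := ε * L / (4 * (4 / ε + 1)) with hδ
  have hδ0 : 0 < δ := by positivity
  let H : ℕ → E := fun p => g (word L (shift^[p] x)) - (L : ℝ) • t
  have hfreq : ∃ N : ℕ, ∀ n ≥ N, ‖∑ p ∈ Finset.range n, H p‖ ≤ δ * n := by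
    have h1 := hx.tendsto_word L g
    rw [hg] at h1
    obtain ⟨N, hN⟩ := Metric.tendsto_atTop.1 h1 δ hδ0
    refine ⟨N + 1, fun n hn => ?_⟩
    have hn0 : (0 : ℝ) < n := by exact_mod_cast (by omega : 0 < n)
    have h2 := (hN n (by omega)).le
    rw [dist_eq_norm] at h2
    have h3 : ∑ p ∈ Finset.range n, H p = (n : ℝ) • ((1 / (n : ℝ)) •
        ∑ p ∈ Finset.range n, g (word L (shift^[p] x)) - (L : ℝ) • t) := by
      rw [smul_sub, smul_smul, mul_one_div_cancel hn0.ne', one_smul, Finset.sum_sub_distrib]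
      simp only [Finset.sum_const, Finset.card_range]
      rw [Nat.cast_smul_eq_nsmul ℝ n]
    rw [h3, norm_smul, Real.norm_of_nonneg hn0.le, mul_comm]
    gcongr
  obtain ⟨N, hN⟩ := hfreq
  -- The first term gives ε * a ≥ 2L, room for at least one block. The second makes 2LC at most ε *
  -- n / 4: one LC for the uncontrolled ends, one for the mean over the extra L symbols.
  obtain ⟨a₁, ha₁⟩ := exists_nat_ge (2 * L / ε + 16 * C * L / ε ^ 2)
  refine ⟨max N a₁, fun a ha φ => ?_⟩
  have haN : N ≤ a := (le_max_left _ _).trans ha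
  have haa : 2 * L / ε + 16 * C * L / ε ^ 2 ≤ a :=
    ha₁.trans (by exact_mod_cast (le_max_right _ _).trans ha)
  have ha2 : 2 * L ≤ ε * a := by
    have h1 : 0 ≤ 16 * C * L / ε ^ 2 := by positivity
    have : 2 * L / ε ≤ a := by linarith
    rwa [div_le_iff₀' hε] at this
  have ha16 : 16 * C * L ≤ ε ^ 2 * a := by
    have h1 : 0 ≤ 2 * L / ε := by positivity
    have : 16 * C * L / ε ^ 2 ≤ a := by linarith
    rwa [div_le_iff₀' (by positivity)] at this
  -- The stretch has length n = (K + 1) * L, between ε * a / 2 and ε * a; one of the K + 1 blocks is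
  -- sacrificed to the choice of phase.
  obtain ⟨K, hK⟩ : ∃ K, ⌊ε * a / L⌋₊ = K + 1 := by
    refine Nat.exists_eq_succ_of_ne_zero ?_
    have : 0 < ⌊ε * a / L⌋₊ := Nat.floor_pos.2 (by rw [one_le_div hL0]; linarith)
    omega
  have hKle : ((K : ℝ) + 1) * L ≤ ε * a := by
    have := Nat.floor_le (a := ε * a / L) (by positivity)
    rw [hK, le_div_iff₀ hL0] at this
    exact_mod_cast this
  have hKge : ε * a ≤ 2 * (((K : ℝ) + 1) * L) := by
    have := Nat.lt_floor_add_one (ε * a / L)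
    rw [hK, div_lt_iff₀ hL0] at this
    push_cast at this
    nlinarith
  obtain ⟨z, hz⟩ := hf.exists_inner_orbitSum_ge hC.le (shift^[a] x) φ hLpos
    (fun p => g (word L (shift^[p] (shift^[a] x)))) (fun p => hgz _ φ) K
  have hn : ((K * L + L : ℕ) : ℝ) = (K + 1) * L := by push_cast; ring
  have hsum : ‖∑ p ∈ Finset.range (K * L), H (p + a)‖ ≤ δ * (2 * a + (K * L : ℕ)) :=
    norm_sum_shifted_le hN haN _
  have hHG : ∑ p ∈ Finset.range (K * L), H (p + a)
      = ∑ p ∈ Finset.range (K * L), g (word L (shift^[p] (shift^[a] x)))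
        - ((K : ℝ) * L * L) • t := by
    simp only [H, Function.iterate_add_apply, Finset.sum_sub_distrib, Finset.sum_const,
      Finset.card_range]
    rw [← Nat.cast_smul_eq_nsmul ℝ, smul_smul]
    push_cast
    rfl
  have h1 := neg_le_of_abs_le (abs_real_inner_le_norm φ (∑ p ∈ Finset.range (K * L), H (p + a)))
  rw [hHG, inner_sub_right, inner_smul_right] at h1
  rw [hHG] at hsum
  have h2 := abs_le.1 (abs_real_inner_le_norm φ t)
  refine ⟨K * L + L, z, by omega, by rw [hn]; exact hKle, ?_, ?_⟩
  · rw [hn]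
    have hL1 : (1 : ℝ) ≤ L := by exact_mod_cast hLpos
    nlinarith
  · rw [inner_sub_right, inner_smul_right, hn]
    set n : ℝ := (K + 1) * L with hn'
    have hn0 : 0 < n := by positivity
    have han : (a : ℝ) ≤ 2 * n / ε := by
      rw [le_div_iff₀' hε]
      exact hKge
    have hbound : δ * (2 * a + (K * L : ℕ)) ≤ L * (ε * n / 4) := by
      have h3 : (2 * a + (K * L : ℕ) : ℝ) ≤ (4 / ε + 1) * n := by
        have h4 : (4 / ε + 1) * n = 2 * (2 * n / ε) + n := by ring
        rw [h4]
        push_cast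
        nlinarith
      calc δ * (2 * a + (K * L : ℕ)) ≤ δ * ((4 / ε + 1) * n) := by gcongr
        _ = L * (ε * n / 4) := by
          rw [hδ]
          field_simp
    set S := ⟪φ, ∑ p ∈ Finset.range (K * L), g (word L (shift^[p] (shift^[a] x)))⟫
    have hφ := norm_nonneg φ
    have h5 : -(L * (ε * n / 4) * ‖φ‖) ≤ S - (K : ℝ) * L * L * ⟪φ, t⟫ := by
      refine le_trans ?_ h1
      rw [neg_le_neg_iff, mul_comm]
      gcongr
      exact hsum.trans hbound
    have h6 : -(ε * n / 4 * ‖φ‖) ≤ 1 / (L : ℝ) * S - (K : ℝ) * L * ⟪φ, t⟫ := by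
      have h7 := mul_le_mul_of_nonneg_left h5 (by positivity : (0 : ℝ) ≤ 1 / L)
      have e1 : 1 / (L : ℝ) * -(L * (ε * n / 4) * ‖φ‖) = -(ε * n / 4 * ‖φ‖) := by
        field_simp
      have e2 : 1 / (L : ℝ) * (S - (K : ℝ) * L * L * ⟪φ, t⟫)
          = 1 / (L : ℝ) * S - (K : ℝ) * L * ⟪φ, t⟫ := by
        field_simp
      rwa [e1, e2] at h7
    have h8 : L * ⟪φ, t⟫ ≤ L * C * ‖φ‖ := by
      have : ⟪φ, t⟫ ≤ C * ‖φ‖ := h2.2.trans (by rw [mul_comm]; gcongr)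
      nlinarith
    have h9 : 2 * K * C ≤ ε * n / 4 := by
      have e1 := mul_le_mul_of_nonneg_left hL8 (Nat.cast_nonneg (α := ℝ) K)
      have e2 : ε * n / 4 = (K * (ε * L) + ε * L) / 4 := by rw [hn']; ring
      have e3 := mul_pos hε hL0
      linarith
    have h10 : 2 * L * C ≤ ε * n / 4 := by
      have e1 := mul_le_mul_of_nonneg_left hKge hε.le
      linarith
    have h11 := mul_le_mul_of_nonneg_right h9 hφ
    have h12 := mul_le_mul_of_nonneg_right h10 hφ
    have h13 : n * ⟪φ, t⟫ = K * L * ⟪φ, t⟫ + L * ⟪φ, t⟫ := by rw [hn']; ring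
    have h14 : 0 ≤ ε * n * ‖φ‖ := by positivity
    have h15 : (2 * K * C + L * C) * ‖φ‖ = 2 * K * C * ‖φ‖ + L * C * ‖φ‖ := by ring
    linarith

end

/-! ### Staged construction of the second sequence -/

/-- If `P ε` holds eventually for every `ε > 0`, then `P (ε a) a` holds eventually for some
sequence `ε` tending to zero. -/
theorem exists_tendsto_zero_of_eventually {P : ℝ → ℕ → Prop}
    (hP : ∀ ε > 0, ∃ a₀, ∀ a ≥ a₀, P ε a) :
    ∃ ε : ℕ → ℝ, (∀ a, 0 < ε a) ∧ Tendsto ε atTop (𝓝 0) ∧ ∃ a₀, ∀ a ≥ a₀, P (ε a) a := by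
  classical
  let κ : ℕ → ℕ := fun a => Nat.findGreatest (fun k => P (1 / ((k : ℝ) + 1)) a) a
  have hκ : Tendsto κ atTop atTop := by
    refine tendsto_atTop.2 fun k => ?_
    obtain ⟨a₀, ha₀⟩ := hP (1 / ((k : ℝ) + 1)) (by positivity)
    filter_upwards [eventually_ge_atTop (max k a₀)] with a ha
    exact Nat.le_findGreatest ((le_max_left _ _).trans ha) (ha₀ a ((le_max_right _ _).trans ha))
  refine ⟨fun a => 1 / ((κ a : ℝ) + 1), fun a => by positivity,
    tendsto_one_div_add_atTop_nhds_zero_nat.comp hκ, ?_⟩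
  -- `Nat.findGreatest` returns 0 when nothing is found, so the case k = 0 has to hold for its
  -- specification to apply.
  obtain ⟨a₀, ha₀⟩ := hP (1 / (((0 : ℕ) : ℝ) + 1)) (by positivity)
  exact ⟨a₀, fun a ha =>
    Nat.findGreatest_spec (P := fun k => P (1 / ((k : ℝ) + 1)) a) (Nat.zero_le a) (ha₀ a ha)⟩

/-- Once M * ε j ≤ δ / 2 the increments telescope to at most δ / 2 * a j ^ 2, and the remaining
constant is absorbed since a tends to infinity. -/
theorem eventually_le_mul_sq {s a ε : ℕ → ℝ} {M : ℝ} (hM : 0 < M) (ha : Monotone a)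
    (ha0 : ∀ j, 0 ≤ a j) (haT : Tendsto a atTop atTop) (hε : Tendsto ε atTop (𝓝 0))
    (hs : ∀ j, s (j + 1) ≤ s j + M * ε j * (a (j + 1) ^ 2 - a j ^ 2)) {δ : ℝ} (hδ : 0 < δ) :
    ∀ᶠ j in atTop, s j ≤ δ * a j ^ 2 := by
  obtain ⟨J, hJ⟩ := eventually_atTop.1 (hε.eventually (gt_mem_nhds (div_pos hδ
    (mul_pos two_pos hM))))
  have h1 : ∀ j ≥ J, s j ≤ |s J| + δ / 2 * a j ^ 2 := by
    intro j hj
    induction j, hj using Nat.le_induction with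
    | base => nlinarith [le_abs_self (s J), sq_nonneg (a J)]
    | succ j hj ih =>
      have h2 : 0 ≤ a (j + 1) ^ 2 - a j ^ 2 :=
        sub_nonneg.2 (pow_le_pow_left₀ (ha0 j) (ha (Nat.le_succ j)) 2)
      have h3 : M * ε j ≤ δ / 2 := by
        have := (hJ j hj).le
        rw [le_div_iff₀ (mul_pos two_pos hM)] at this
        linarith
      have h4 := mul_le_mul_of_nonneg_right h3 h2
      linarith [hs j]
  have h5 : Tendsto (fun j => δ / 2 * a j ^ 2) atTop atTop :=
    ((tendsto_pow_atTop two_ne_zero).comp haT).const_mul_atTop (half_pos hδ)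
  filter_upwards [eventually_ge_atTop J, h5.eventually (eventually_ge_atTop |s J|)] with j hj hj'
  linarith [h1 j hj]

theorem exists_between_of_strictMono {a : ℕ → ℕ} (ha : StrictMono a) {J m : ℕ} (hm : a J ≤ m) :
    ∃ j ≥ J, a j ≤ m ∧ m < a (j + 1) := by
  by_contra! hcon
  have h1 : ∀ j ≥ J, a j ≤ m := by
    intro j hj
    induction j, hj using Nat.le_induction with
    | base => exact hm
    | succ j hj ih => exact hcon j hj ih
  have h2 := h1 (max J (m + 1)) (le_max_left _ _)
  have h3 := ha.le_apply (x := max J (m + 1))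
  have h4 := le_max_right J (m + 1)
  omega

section

variable {A B E : Type*} [TopologicalSpace A] [DiscreteTopology A] [Fintype A]
  [MeasurableSpace A] [BorelSpace A]
  [TopologicalSpace B] [DiscreteTopology B] [Finite B] [MeasurableSpace B] [BorelSpace B]
  [NormedAddCommGroup E] [InnerProductSpace ℝ E] [CompleteSpace E]
  {f : (ℕ → A) × (ℕ → B) → E} {C : ℝ}

/-- A generic first sequence can be completed by a second one so that the orbit averages of a
given Hilbert space valued function converge to its integral. -/
theorem IsTame.exists_tendsto_average [Nonempty A] [Nonempty B] (hf : IsTame f C) (hC : 0 < C)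
    (ξ : Measure ((ℕ → A) × (ℕ → B))) [IsProbabilityMeasure ξ]
    (hξ : MeasurePreserving (Prod.map shift shift) ξ ξ) {x : ℕ → A}
    (hx : IsGeneric shift x (ξ.map Prod.fst)) :
    ∃ y : ℕ → B, Tendsto (fun n : ℕ => (1 / (n : ℝ)) • orbitSum f x y n) atTop
      (𝓝 (∫ u, f u ∂ξ)) := by
  obtain ⟨ε, hε0, hεT, a₀, ha₀⟩ := exists_tendsto_zero_of_eventually
    fun ε hε => hf.exists_continuation hC ξ hξ hx (ε := ε) hε
  set t := ∫ u, f u ∂ξ with ht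
  have htC : ‖t‖ ≤ C := by
    simpa using norm_integral_le_of_norm_le_const (μ := ξ) (Eventually.of_forall hf.bound)
  have hdev : ∀ (x : ℕ → A) (y : ℕ → B) (n : ℕ), ‖orbitSum f x y n - (n : ℝ) • t‖ ≤ 2 * C * n := by
    intro x y n
    refine (norm_sub_le _ _).trans ?_
    rw [norm_smul, Real.norm_natCast]
    nlinarith [hf.norm_orbitSum_le x y n, mul_le_mul_of_nonneg_left htC (Nat.cast_nonneg (α := ℝ) n)]
  choose! n z hn0 hnle hnC hnz using ha₀
  obtain ⟨b⟩ := ‹Nonempty B›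
  let V : (ℕ → B) → ℕ → E := fun y m => orbitSum f x y m - (m : ℝ) • t
  -- The continuation is requested in the direction opposite to the current deviation.
  let next : ℕ × (ℕ → B) → ℕ × (ℕ → B) := fun p =>
    (p.1 + n p.1 (-V p.2 p.1), splice p.1 p.2 (z p.1 (-V p.2 p.1)))
  let s : ℕ → ℕ × (ℕ → B) := fun j => next^[j] (a₀, fun _ => b)
  let a : ℕ → ℕ := fun j => (s j).1
  let Y : ℕ → ℕ → B := fun j => (s j).2
  let w : ℕ → E := fun j => V (Y j) (a j)
  let N : ℕ → ℕ := fun j => n (a j) (-w j)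
  let Z : ℕ → ℕ → B := fun j => z (a j) (-w j)
  have hs : ∀ j, s (j + 1) = next (s j) := fun j => Function.iterate_succ_apply' _ _ _
  have ha_succ : ∀ j, a (j + 1) = a j + N j := fun j => congrArg Prod.fst (hs j)
  have hY_succ : ∀ j, Y (j + 1) = splice (a j) (Y j) (Z j) := fun j => congrArg Prod.snd (hs j)
  have ha_ge : ∀ j, a₀ ≤ a j := by
    intro j
    induction j with
    | zero => exact le_rfl
    | succ j ih => rw [ha_succ]; omega
  have hN0 : ∀ j, 0 < N j := fun j => hn0 _ (ha_ge j) _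
  have hNle : ∀ j, (N j : ℝ) ≤ ε (a j) * a j := fun j => hnle _ (ha_ge j) _
  have hNC : ∀ j, C ≤ ε (a j) * N j := fun j => hnC _ (ha_ge j) _
  have ha_mono : StrictMono a := strictMono_nat_of_lt_succ fun j => by
    rw [ha_succ]
    have := hN0 j
    omega
  have hY_agree : ∀ j k, j ≤ k → ∀ i < a j, Y k i = Y j i := by
    intro j k hjk
    induction k, hjk using Nat.le_induction with
    | base => exact fun i _ => rfl
    | succ k hk ih =>
      intro i hi
      rw [hY_succ, splice_of_lt _ _ (hi.trans_le (ha_mono.monotone hk)), ih i hi]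
  -- Stage j fixes all symbols before a j, and a (i + 1) > i by strict monotonicity, so symbol i is
  -- final at stage i + 1.
  let y : ℕ → B := fun i => Y (i + 1) i
  have hy : ∀ j, ∀ i < a j, y i = Y j i := by
    intro j i hi
    rcases le_total (i + 1) j with h | h
    · exact (hY_agree _ _ h i (by have := ha_mono.le_apply (x := i + 1); omega)).symm
    · exact hY_agree _ _ h i hi
  have hVadd : ∀ (u : ℕ → B) (m k : ℕ), V u (m + k) = V u m +
      (orbitSum f (shift^[m] x) (shift^[m] u) k - (k : ℝ) • t) := by
    intro u m k
    simp only [V, orbitSum_add]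
    push_cast
    rw [add_smul]
    abel
  have hVclose : ∀ (u v : ℕ → B) (m : ℕ), (∀ i < m, u i = v i) → ‖V u m - V v m‖ ≤ C := by
    intro u v m huv
    simp only [V, sub_sub_sub_cancel_right]
    exact hf.norm_orbitSum_sub_le hC.le (fun _ _ => rfl) huv
  -- Expand ‖w + (d + β)‖², where d is the seam error and β the deviation of the new stretch. The
  -- cross terms give at most 8C·εaN and the square at most 9C²·εaN, while a² grows by at least 2aN.
  have henergy : ∀ j, ‖w (j + 1)‖ ^ 2 ≤ ‖w j‖ ^ 2
      + (4 * C + 5 * C ^ 2) * ε (a j) * ((a (j + 1) : ℝ) ^ 2 - (a j : ℝ) ^ 2) := by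
    intro j
    set β := orbitSum f (shift^[a j] x) (Z j) (N j) - (N j : ℝ) • t with hβ
    set d := V (Y (j + 1)) (a j) - w j with hd
    have hw1 : w (j + 1) = w j + (d + β) := by
      have h1 : w (j + 1) = V (Y (j + 1)) (a (j + 1)) := rfl
      rw [h1, ha_succ, hVadd, hd, hβ]
      have h2 : shift^[a j] (Y (j + 1)) = Z j := by rw [hY_succ, shift_iterate_splice]
      rw [h2]
      abel
    have hdC : ‖d‖ ≤ C := hVclose _ _ _ fun i hi => hY_agree _ _ (Nat.le_succ j) i hi
    have hβC : ‖β‖ ≤ 2 * C * N j := hdev _ _ _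
    have hinner : ⟪w j, β⟫ ≤ ε (a j) * N j * ‖w j‖ := by
      have h1 := hnz _ (ha_ge j) (-w j)
      rw [inner_neg_left, norm_neg, neg_le_neg_iff] at h1
      exact h1
    have hinner' : ⟪w j, d⟫ ≤ ‖w j‖ * C :=
      (real_inner_le_norm _ _).trans (by gcongr)
    have hwj : ‖w j‖ ≤ 2 * C * a j := hdev _ _ _
    rw [hw1, norm_add_sq_real, inner_add_right, ha_succ, add_assoc]
    gcongr
    have hN1 : (1 : ℝ) ≤ N j := by exact_mod_cast hN0 j
    have h1 : ‖d + β‖ ≤ 3 * C * N j := (norm_add_le _ _).trans (by nlinarith)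
    have h2 : ‖d + β‖ ^ 2 ≤ (3 * C * N j) ^ 2 := pow_le_pow_left₀ (norm_nonneg _) h1 2
    have h3 : (3 * C * N j) ^ 2 ≤ 9 * C ^ 2 * (ε (a j) * a j * N j) := by
      have := mul_le_mul_of_nonneg_right (hNle j) (Nat.cast_nonneg (α := ℝ) (N j))
      have := mul_le_mul_of_nonneg_left this (by positivity : 0 ≤ 9 * C ^ 2)
      linarith
    have h4 : 2 * (⟪w j, d⟫ + ⟪w j, β⟫) ≤ 8 * C * (ε (a j) * a j * N j) := by
      have h5 : ‖w j‖ * C ≤ ‖w j‖ * (ε (a j) * N j) := by gcongr; exact hNC j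
      have h6 : ‖w j‖ * (ε (a j) * N j) ≤ 2 * C * a j * (ε (a j) * N j) := by
        have := hε0 (a j)
        gcongr
      linarith
    push_cast
    have h7 : ((a j : ℝ) + N j) ^ 2 - (a j : ℝ) ^ 2 = 2 * (a j * N j) + (N j : ℝ) ^ 2 := by ring
    have h8 : 0 ≤ (4 * C + 5 * C ^ 2) * ε (a j) * (N j : ℝ) ^ 2 := by
      have := hε0 (a j)
      positivity
    have h9 : 0 ≤ C ^ 2 * (ε (a j) * a j * N j) := by
      have := hε0 (a j)
      positivity
    rw [h7]
    linarith
  have haT : Tendsto (fun j => (a j : ℝ)) atTop atTop :=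
    tendsto_natCast_atTop_atTop.comp ha_mono.tendsto_atTop
  have hεaT : Tendsto (fun j => ε (a j)) atTop (𝓝 0) := hεT.comp ha_mono.tendsto_atTop
  have hwsmall : ∀ δ > 0, ∀ᶠ j in atTop, ‖w j‖ ≤ δ * a j := by
    intro δ hδ
    have h1 := eventually_le_mul_sq (s := fun j => ‖w j‖ ^ 2) (a := fun j => (a j : ℝ))
      (by positivity : 0 < 4 * C + 5 * C ^ 2) (fun i j hij => Nat.cast_le.2 (ha_mono.monotone hij))
      (fun j => Nat.cast_nonneg _) haT hεaT henergy (pow_pos hδ 2)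
    filter_upwards [h1] with j hj
    rw [← mul_pow] at hj
    exact le_of_sq_le_sq hj (by positivity)
  refine ⟨y, ?_⟩
  -- Between two stages the deviation moves by at most 2C * N j, which is small against a j because
  -- N j ≤ ε (a j) * a j.
  have hfinal : ∀ δ > 0, ∃ m₀, ∀ m ≥ m₀, ‖V y m‖ ≤ δ * m := by
    intro δ hδ
    have hδ3 : 0 < δ / 3 := by positivity
    have e1 : ∀ᶠ j in atTop, C ≤ δ / 3 * a j :=
      (haT.const_mul_atTop hδ3).eventually (eventually_ge_atTop C)
    have e2 : ∀ᶠ j in atTop, ε (a j) < δ / 3 / (2 * C) :=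
      hεaT.eventually (gt_mem_nhds (by positivity))
    obtain ⟨J, hJ⟩ := eventually_atTop.1 ((hwsmall _ hδ3).and (e1.and e2))
    refine ⟨a J, fun m hm => ?_⟩
    obtain ⟨j, hj, hjm, hjm'⟩ := exists_between_of_strictMono ha_mono hm
    obtain ⟨f1, f2, f3⟩ := hJ j hj
    obtain ⟨k, rfl⟩ := Nat.exists_eq_add_of_le hjm
    have hk : (k : ℝ) ≤ N j := by
      rw [ha_succ] at hjm'
      exact_mod_cast (by omega : k ≤ N j)
    rw [hVadd]
    have g1 : ‖V y (a j)‖ ≤ ‖w j‖ + C := by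
      have := hVclose _ _ _ (hy j)
      have h2 := norm_le_norm_add_norm_sub' (V y (a j)) (w j)
      exact h2.trans (by gcongr)
    have g2 := hdev (shift^[a j] x) (shift^[a j] y) k
    have g3 : 2 * C * k ≤ δ / 3 * a j := by
      rw [lt_div_iff₀ (by positivity)] at f3
      have h1 := mul_le_mul_of_nonneg_right f3.le (Nat.cast_nonneg (α := ℝ) (a j))
      have h2 := mul_le_mul_of_nonneg_left (hk.trans (hNle j)) (by positivity : 0 ≤ 2 * C)
      linarith
    refine (norm_add_le _ _).trans ?_
    push_cast
    have := mul_nonneg hδ.le (Nat.cast_nonneg (α := ℝ) k)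
    linarith
  rw [Metric.tendsto_atTop]
  intro η hη
  obtain ⟨m₀, hm₀⟩ := hfinal (η / 2) (half_pos hη)
  refine ⟨m₀ + 1, fun m hm => ?_⟩
  have hm0 : (0 : ℝ) < m := by exact_mod_cast (by omega : 0 < m)
  have h1 := hm₀ m (by omega)
  have h2 : (1 / (m : ℝ)) • orbitSum f x y m - t = (1 / (m : ℝ)) • V y m := by
    simp only [V]
    rw [smul_sub, smul_smul, one_div_mul_cancel hm0.ne', one_smul]
  rw [dist_eq_norm, h2, norm_smul, Real.norm_of_nonneg (by positivity)]
  calc 1 / (m : ℝ) * ‖V y m‖ ≤ 1 / (m : ℝ) * (η / 2 * m) := by gcongr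
    _ = η / 2 := by field_simp
    _ < η := half_lt_self hη

end

/-! ### Encoding word frequencies in a Hilbert space -/

/-- The pair of initial words of length `m` of a pair of sequences. -/
def pairWord {A B : Type*} (m : ℕ) (u : (ℕ → A) × (ℕ → B)) : (Fin m → A) × (Fin m → B) :=
  (word m u.1, word m u.2)

theorem pairWord_eq_iff {A B : Type*} {m : ℕ} {u v : (ℕ → A) × (ℕ → B)} :
    pairWord m u = pairWord m v ↔ (∀ i < m, u.1 i = v.1 i) ∧ ∀ i < m, u.2 i = v.2 i := by
  rw [pairWord, pairWord, Prod.mk.injEq, word_eq_iff, word_eq_iff]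

theorem pairWord_eq_of_le {A B : Type*} {m n : ℕ} (hmn : m ≤ n) {u v : (ℕ → A) × (ℕ → B)}
    (h : pairWord n u = pairWord n v) : pairWord m u = pairWord m v := by
  rw [pairWord_eq_iff] at h ⊢
  exact ⟨fun i hi => h.1 i (hi.trans_le hmn), fun i hi => h.2 i (hi.trans_le hmn)⟩

/-- A Hilbert space with one basis vector for each pair of words of equal length. -/
abbrev WordSpace (A B : Type*) : Type _ :=
  lp (fun _ : Σ m : ℕ, (Fin m → A) × (Fin m → B) => ℝ) 2

section

variable {A B : Type*}

open Classical in
/-- The basis vector of `WordSpace A B` belonging to a pair of words. -/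
noncomputable def wordVec (i : Σ m : ℕ, (Fin m → A) × (Fin m → B)) : WordSpace A B :=
  lp.single 2 i (1 : ℝ)

theorem norm_wordVec (i : Σ m : ℕ, (Fin m → A) × (Fin m → B)) : ‖wordVec i‖ = 1 := by
  classical
  rw [wordVec, lp.norm_single (by norm_num), norm_one]

open Classical in
theorem inner_wordVec (i j : Σ m : ℕ, (Fin m → A) × (Fin m → B)) :
    ⟪wordVec i, wordVec j⟫ = if i = j then (1 : ℝ) else 0 := by
  rw [wordVec, lp.inner_single_left, wordVec, lp.single_apply]
  by_cases h : i = j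
  · subst h
    simp
  · simp [h]

/-- The vector recording, with geometric weights, all initial words of a pair of sequences. -/
noncomputable def wordMap (u : (ℕ → A) × (ℕ → B)) : WordSpace A B :=
  ∑' m : ℕ, (1 / 2 : ℝ) ^ m • wordVec ⟨m, pairWord m u⟩

theorem norm_wordMap_term (u : (ℕ → A) × (ℕ → B)) (m : ℕ) :
    ‖(1 / 2 : ℝ) ^ m • wordVec ⟨m, pairWord m u⟩‖ = (1 / 2) ^ m := by
  rw [norm_smul, norm_wordVec, mul_one, Real.norm_of_nonneg (by positivity)]

theorem summable_wordMap (u : (ℕ → A) × (ℕ → B)) :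
    Summable fun m : ℕ => (1 / 2 : ℝ) ^ m • wordVec ⟨m, pairWord m u⟩ :=
  Summable.of_norm_bounded summable_geometric_two fun m => (norm_wordMap_term u m).le

/-- Agreement on k symbols cancels all terms with m ≤ k; the tail is at most the sum of 2·2⁻ᵐ over m
> k, that is 2·2⁻ᵏ. -/
theorem isTame_wordMap : IsTame (wordMap : (ℕ → A) × (ℕ → B) → WordSpace A B) 2 where
  bound u := tsum_of_norm_bounded hasSum_geometric_two fun m => (norm_wordMap_term u m).le
  close k x x' y y' hx hy := by
    rw [wordMap, wordMap, ← (summable_wordMap (x, y)).tsum_sub (summable_wordMap (x', y')),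
      ← ((summable_wordMap (x, y)).sub (summable_wordMap (x', y'))).sum_add_tsum_nat_add (k + 1)]
    have h0 : ∑ m ∈ Finset.range (k + 1), ((1 / 2 : ℝ) ^ m • wordVec ⟨m, pairWord m (x, y)⟩
        - (1 / 2 : ℝ) ^ m • wordVec ⟨m, pairWord m (x', y')⟩) = 0 := by
      refine Finset.sum_eq_zero fun m hm => ?_
      have hm' : m ≤ k := Nat.lt_succ_iff.1 (Finset.mem_range.1 hm)
      have h : pairWord k (x, y) = pairWord k (x', y') := pairWord_eq_iff.2 ⟨hx, hy⟩
      rw [pairWord_eq_of_le hm' h, sub_self]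
    rw [h0, zero_add]
    have h1 : HasSum (fun m : ℕ => (1 / 2 : ℝ) ^ m * (2 * (1 / 2) ^ (k + 1))) (2 * (1 / 2) ^ k) := by
      have h2 : (2 : ℝ) * (1 / 2) ^ k = 2 * (2 * (1 / 2) ^ (k + 1)) := by
        rw [pow_succ]
        ring
      rw [h2]
      exact hasSum_geometric_two.mul_right _
    refine tsum_of_norm_bounded h1 fun m => (norm_sub_le _ _).trans ?_
    rw [norm_wordMap_term, norm_wordMap_term]
    exact le_of_eq (by ring)

/-- By orthonormality only the term of length m can contribute, so indicators of cylinders become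
continuous linear functionals of `wordMap`. -/
theorem inner_wordVec_wordMap [DecidableEq A] [DecidableEq B] (m : ℕ)
    (w : (Fin m → A) × (Fin m → B)) (u : (ℕ → A) × (ℕ → B)) :
    ⟪wordVec ⟨m, w⟩, wordMap u⟫ = if pairWord m u = w then (1 / 2 : ℝ) ^ m else 0 := by
  have h1 := (innerSL ℝ (wordVec (⟨m, w⟩ : Σ m : ℕ, (Fin m → A) × (Fin m → B)))).map_tsum
    (summable_wordMap u)
  simp only [innerSL_apply_apply] at h1
  rw [wordMap, h1, tsum_eq_single m]
  · rw [inner_smul_right, inner_wordVec]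
    simp [eq_comm]
  · intro k hk
    rw [inner_smul_right, inner_wordVec, if_neg, mul_zero]
    intro h
    exact hk (congrArg Sigma.fst h).symm

/-- Every function of the initial words of length `m` is a linear functional of `wordMap`. -/
theorem exists_inner_wordMap_eq [Fintype A] [Fintype B] (m : ℕ)
    (g : (Fin m → A) × (Fin m → B) → ℝ) :
    ∃ ψ : WordSpace A B, ∀ u, ⟪ψ, wordMap u⟫ = g (pairWord m u) := by
  classical
  refine ⟨∑ w, ((2 : ℝ) ^ m * g w) • wordVec ⟨m, w⟩, fun u => ?_⟩
  simp only [sum_inner, inner_smul_left, inner_wordVec_wordMap]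
  simp only [mul_ite, mul_zero, Finset.sum_ite_eq, Finset.mem_univ, if_true, conj_trivial]
  rw [mul_right_comm, ← mul_pow]
  norm_num

end

/-! ### From word frequencies to generic pairs -/

section

variable {A B : Type*} [TopologicalSpace A] [DiscreteTopology A]
  [TopologicalSpace B] [DiscreteTopology B]

theorem exists_word_subset_of_mem_nhds {x : ℕ → A} {s : Set (ℕ → A)} (hs : s ∈ 𝓝 x) :
    ∃ m, {x' | word m x' = word m x} ⊆ s := by
  obtain ⟨_, ⟨z, m, rfl⟩, hxz, hz⟩ :=
    (PiNat.isTopologicalBasis_cylinders fun _ : ℕ => A).mem_nhds_iff.1 hs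
  refine ⟨m, fun x' hx' => hz ?_⟩
  rw [PiNat.mem_cylinder_iff] at hxz ⊢
  intro i hi
  rw [word_eq_iff.1 hx' i hi, hxz i hi]

theorem exists_pairWord_subset_of_mem_nhds {u : (ℕ → A) × (ℕ → B)}
    {s : Set ((ℕ → A) × (ℕ → B))} (hs : s ∈ 𝓝 u) :
    ∃ m, {v | pairWord m v = pairWord m u} ⊆ s := by
  obtain ⟨s₁, h₁, s₂, h₂, hs'⟩ := mem_nhds_prod_iff.1 hs
  obtain ⟨m₁, hm₁⟩ := exists_word_subset_of_mem_nhds h₁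
  obtain ⟨m₂, hm₂⟩ := exists_word_subset_of_mem_nhds h₂
  refine ⟨max m₁ m₂, fun v hv => hs' ⟨hm₁ ?_, hm₂ ?_⟩⟩
  · exact congrArg Prod.fst (pairWord_eq_of_le (le_max_left m₁ m₂) hv)
  · exact congrArg Prod.snd (pairWord_eq_of_le (le_max_right m₁ m₂) hv)

theorem pairWord_eq_mem_nhds (m : ℕ) (u : (ℕ → A) × (ℕ → B)) :
    {v | pairWord m v = pairWord m u} ∈ 𝓝 u := by
  have h1 : {x | word m x = word m u.1} ×ˢ {y | word m y = word m u.2} ∈ 𝓝 u :=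
    prod_mem_nhds ((isClopen_word_eq m _).isOpen.mem_nhds rfl)
      ((isClopen_word_eq m _).isOpen.mem_nhds rfl)
  exact mem_of_superset h1 fun v hv => Prod.ext hv.1 hv.2

/-- A continuous function on pairs of sequences is uniformly close to a function of finitely many
coordinates. -/
theorem exists_word_approx [Finite A] [Finite B] {F : (ℕ → A) × (ℕ → B) → ℝ} (hF : Continuous F)
    {ε : ℝ} (hε : 0 < ε) : ∃ m, ∀ u v, pairWord m u = pairWord m v → |F u - F v| ≤ ε := by
  have h1 : ∀ u, ∃ m, ∀ v, pairWord m v = pairWord m u → |F v - F u| < ε / 2 := by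
    intro u
    obtain ⟨m, hm⟩ := exists_pairWord_subset_of_mem_nhds
      (hF.continuousAt.preimage_mem_nhds (Metric.ball_mem_nhds (F u) (half_pos hε)))
    exact ⟨m, fun v hv => hm hv⟩
  choose m hm using h1
  obtain ⟨t, ht⟩ := CompactSpace.elim_nhds_subcover
    (fun u => {v | pairWord (m u) v = pairWord (m u) u}) fun u => pairWord_eq_mem_nhds _ u
  refine ⟨t.sup m, fun u v huv => ?_⟩
  have hu : u ∈ ⋃ u₀ ∈ t, {v | pairWord (m u₀) v = pairWord (m u₀) u₀} := by
    rw [ht]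
    trivial
  simp only [Set.mem_iUnion] at hu
  obtain ⟨u₀, hu₀, h2⟩ := hu
  have h3 := hm u₀ u h2
  have h4 := hm u₀ v ((pairWord_eq_of_le (Finset.le_sup hu₀) huv).symm.trans h2)
  rw [abs_lt] at h3 h4
  rw [abs_le]
  constructor <;> linarith

theorem continuous_wordFunction (m : ℕ) (g : (Fin m → A) × (Fin m → B) → ℝ) :
    Continuous fun u : (ℕ → A) × (ℕ → B) => g (pairWord m u) := by
  have : Continuous (pairWord m : (ℕ → A) × (ℕ → B) → _) :=
    ((continuous_word m).comp continuous_fst).prodMk ((continuous_word m).comp continuous_snd)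
  exact continuous_of_discreteTopology.comp this

variable [Fintype A] [MeasurableSpace A] [BorelSpace A]
  [Fintype B] [MeasurableSpace B] [BorelSpace B]

theorem tendsto_average_real {ξ : Measure ((ℕ → A) × (ℕ → B))} [IsProbabilityMeasure ξ]
    {u : (ℕ → A) × (ℕ → B)}
    (hu : Tendsto (fun n : ℕ => (1 / (n : ℝ)) • orbitSum wordMap u.1 u.2 n) atTop
      (𝓝 (∫ v, wordMap v ∂ξ))) {F : (ℕ → A) × (ℕ → B) → ℝ} (hF : Continuous F) :
    Tendsto (fun n : ℕ => (1 / (n : ℝ)) *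
      ∑ i ∈ Finset.range n, F ((Prod.map shift shift)^[i] u)) atTop (𝓝 (∫ v, F v ∂ξ)) := by
  have hword : ∀ (m : ℕ) (g : (Fin m → A) × (Fin m → B) → ℝ), Tendsto (fun n : ℕ =>
      (1 / (n : ℝ)) * ∑ i ∈ Finset.range n, g (pairWord m ((Prod.map shift shift)^[i] u))) atTop
      (𝓝 (∫ v, g (pairWord m v) ∂ξ)) := by
    intro m g
    obtain ⟨ψ, hψ⟩ := exists_inner_wordMap_eq m g
    have h1 : Tendsto (fun n : ℕ => ⟪ψ, (1 / (n : ℝ)) • orbitSum wordMap u.1 u.2 n⟫) atTop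
        (𝓝 ⟪ψ, ∫ v, wordMap v ∂ξ⟫) := tendsto_const_nhds.inner hu
    rw [← integral_inner (integrable_of_continuous_prod isTame_wordMap.continuous ξ)] at h1
    simp only [hψ] at h1
    refine h1.congr fun n => ?_
    simp only [orbitSum, inner_smul_right, inner_sum, hψ, prodMap_shift_iterate]
  rw [Metric.tendsto_atTop]
  intro ε hε
  obtain ⟨m, hm⟩ := exists_word_approx hF (by positivity : 0 < ε / 4)
  have : Nonempty ((ℕ → A) × (ℕ → B)) := ⟨u⟩
  -- The value of F at some pair with the given initial words; every word pair that occurs below is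
  -- attained.
  let g : (Fin m → A) × (Fin m → B) → ℝ := fun w => F (Function.invFun (pairWord m) w)
  have hg : ∀ v, |F v - g (pairWord m v)| ≤ ε / 4 := fun v =>
    hm _ _ (Function.invFun_eq ⟨v, rfl⟩).symm
  obtain ⟨N, hN⟩ := Metric.tendsto_atTop.1 (hword m g) (ε / 4) (by positivity)
  refine ⟨N, fun n hn => ?_⟩
  have h1 := hN n hn
  rw [Real.dist_eq] at h1 ⊢
  have h2 : |∫ v, F v ∂ξ - ∫ v, g (pairWord m v) ∂ξ| ≤ ε / 4 := by
    rw [← integral_sub (integrable_of_continuous_prod hF ξ)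
      (integrable_of_continuous_prod (continuous_wordFunction m g) ξ)]
    simpa using norm_integral_le_of_norm_le_const (μ := ξ)
      (f := fun v => F v - g (pairWord m v)) (Eventually.of_forall hg)
  have h3 : |1 / (n : ℝ) * ∑ i ∈ Finset.range n, F ((Prod.map shift shift)^[i] u)
      - 1 / (n : ℝ) * ∑ i ∈ Finset.range n, g (pairWord m ((Prod.map shift shift)^[i] u))|
      ≤ ε / 4 := by
    rw [← mul_sub, ← Finset.sum_sub_distrib, abs_mul, abs_of_nonneg (by positivity)]
    rcases Nat.eq_zero_or_pos n with rfl | hn0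
    · simp only [Finset.range_zero, Finset.sum_empty, abs_zero, mul_zero]
      positivity
    · have hn0' : (0 : ℝ) < n := by exact_mod_cast hn0
      have h4 := (Finset.abs_sum_le_sum_abs (fun i => F ((Prod.map shift shift)^[i] u)
        - g (pairWord m ((Prod.map shift shift)^[i] u))) (Finset.range n)).trans
          (Finset.sum_le_sum fun i _ => hg _)
      rw [Finset.sum_const, Finset.card_range, nsmul_eq_mul] at h4
      rw [one_div, inv_mul_le_iff₀ hn0']
      exact h4
  rw [abs_lt] at h1 ⊢
  rw [abs_le] at h2 h3
  constructor <;> linarith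

/-- **Lifting of generic points** (Kamae): if `x` is generic for the first marginal of an invariant
measure `ξ`, then some pair `(x, y)` is generic for `ξ`. -/
theorem exists_isGeneric_lift [Nonempty B] (ξ : Measure ((ℕ → A) × (ℕ → B)))
    (hξ : IsInvariantProb (Prod.map shift shift) ξ) {x : ℕ → A}
    (hx : IsGeneric shift x (ξ.map Prod.fst)) :
    ∃ y : ℕ → B, IsGeneric (Prod.map shift shift) (x, y) ξ := by
  have := hξ.prob
  have : Nonempty A := ⟨x 0⟩
  obtain ⟨y, hy⟩ := isTame_wordMap.exists_tendsto_average (by norm_num : (0 : ℝ) < 2) ξ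
    hξ.invariant hx
  refine ⟨y, isGeneric_of_tendsto_range fun f hf => ?_⟩
  have hre := tendsto_average_real (u := (x, y)) hy (Complex.continuous_re.comp hf)
  have him := tendsto_average_real (u := (x, y)) hy (Complex.continuous_im.comp hf)
  have hint := integrable_of_continuous_prod hf ξ
  have h1 := ((Complex.continuous_ofReal.tendsto _).comp hre).add
    (((Complex.continuous_ofReal.tendsto _).comp him).mul_const Complex.I)
  have h2 := integral_re_add_im hint
  simp only [Function.comp_def] at h1
  convert h1 using 1
  · funext n
    push_cast
    rw [mul_assoc, ← mul_add, Finset.sum_mul, ← Finset.sum_add_distrib]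
    simp only [Complex.re_add_im]
  · exact congrArg 𝓝 h2.symm

end

/-! ### Empirical measures and their limits -/

theorem measure_eq_of_integral_continuous_eq {X : Type*} [TopologicalSpace X]
    [HasOuterApproxClosed X] [MeasurableSpace X] [BorelSpace X] {μ ν : Measure X}
    [IsFiniteMeasure μ] [IsFiniteMeasure ν]
    (h : ∀ f : X → ℂ, Continuous f → ∫ z, f z ∂μ = ∫ z, f z ∂ν) : μ = ν := by
  refine ext_of_forall_integral_eq_of_IsFiniteMeasure fun f => ?_
  have h1 := h (fun z => (f z : ℂ)) (Complex.continuous_ofReal.comp f.continuous)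
  rw [integral_complex_ofReal, integral_complex_ofReal] at h1
  exact_mod_cast h1

section

variable {X : Type*} [TopologicalSpace X] [T2Space X] [MeasurableSpace X] [BorelSpace X]

/-- The uniform distribution on the first `n + 1` points of an orbit. -/
noncomputable def empiricalMeasure (T : X → X) (u : X) (n : ℕ) : ProbabilityMeasure X :=
  ⟨((n + 1 : ℕ) : ENNReal)⁻¹ • ∑ i ∈ Finset.range (n + 1), Measure.dirac (T^[i] u), ⟨by
    simp only [Measure.smul_apply, Measure.finsetSum_apply, measure_univ, Finset.sum_const,
      Finset.card_range, nsmul_eq_mul, mul_one, smul_eq_mul]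
    exact ENNReal.inv_mul_cancel (by simp) (ENNReal.natCast_ne_top _)⟩⟩

theorem integral_empiricalMeasure (T : X → X) (u : X) (n : ℕ) (f : X → ℂ) :
    ∫ z, f z ∂(empiricalMeasure T u n : Measure X)
      = (1 / ((n + 1 : ℕ) : ℂ)) * ∑ i ∈ Finset.range (n + 1), f (T^[i] u) := by
  change ∫ z, f z ∂(((n + 1 : ℕ) : ENNReal)⁻¹ • ∑ i ∈ Finset.range (n + 1),
    Measure.dirac (T^[i] u)) = _
  rw [integral_smul_measure, integral_finsetSum_measure]
  · simp only [integral_dirac]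
    rw [ENNReal.toReal_inv, ENNReal.toReal_natCast, Complex.real_smul, one_div, Complex.ofReal_inv,
      Complex.ofReal_natCast]
  · exact fun i _ => integrable_dirac (by simp)

/-- Along an ultrafilter, the orbit averages of continuous functions converge to the integrals with
respect to a probability measure. -/
theorem exists_limit_measure [CompactSpace X] (T : X → X) (u : X) {U : Ultrafilter ℕ}
    (hU : (U : Filter ℕ) ≤ atTop) :
    ∃ ξ : Measure X, IsProbabilityMeasure ξ ∧ ∀ f : X → ℂ, Continuous f →
      Tendsto (fun n : ℕ => (1 / (n : ℂ)) * ∑ i ∈ Finset.range n, f (T^[i] u)) U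
        (𝓝 (∫ z, f z ∂ξ)) := by
  -- The space of probability measures on a compact space is compact, so the image ultrafilter
  -- converges. The shift by one matches the n + 1 points in `empiricalMeasure`, which avoid an
  -- empty average.
  let V : Ultrafilter (ProbabilityMeasure X) := U.map fun n => empiricalMeasure T u (n - 1)
  refine ⟨V.lim, inferInstance, fun f hf => ?_⟩
  have h1 : Tendsto (fun n => empiricalMeasure T u (n - 1)) U (𝓝 V.lim) := V.le_nhds_lim
  have h2 := (ProbabilityMeasure.tendsto_iff_forall_integral_rclike_tendsto ℂ).1 h1
    (BoundedContinuousFunction.mkOfCompact ⟨f, hf⟩)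
  refine h2.congr' ?_
  filter_upwards [hU (eventually_ge_atTop 1)] with n hn
  simp only [BoundedContinuousFunction.mkOfCompact_apply, ContinuousMap.coe_mk]
  rw [integral_empiricalMeasure, Nat.sub_add_cancel hn]

end

/-- Replacing f by f ∘ T moves the averaging window by one step, and the two boundary terms vanish
after division by n. -/
theorem integral_comp_eq_of_tendsto {X : Type*} [TopologicalSpace X] [CompactSpace X]
    [MeasurableSpace X] {T : X → X} (hT : Continuous T) {u : X} {U : Ultrafilter ℕ}
    (hU : (U : Filter ℕ) ≤ atTop) {ξ : Measure X}
    (hξ : ∀ f : X → ℂ, Continuous f →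
      Tendsto (fun n : ℕ => (1 / (n : ℂ)) * ∑ i ∈ Finset.range n, f (T^[i] u)) U
        (𝓝 (∫ z, f z ∂ξ))) {f : X → ℂ} (hf : Continuous f) :
    ∫ z, f (T z) ∂ξ = ∫ z, f z ∂ξ := by
  obtain ⟨C, hC⟩ := isCompact_univ.exists_bound_of_continuousOn hf.continuousOn
  have h1 := tendsto_average_Icc_sub_range (h := fun i => f (T^[i] u)) fun i => hC _ trivial
  have h2 := (hξ _ (hf.comp hT)).sub (hξ f hf)
  refine sub_eq_zero.1 (tendsto_nhds_unique h2 ((h1.mono_left hU).congr fun n => ?_))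
  rw [sum_Icc_one_eq_sum_range]
  simp only [Function.comp, Function.iterate_succ_apply']

/-! ### Block correlations and joinings -/

theorem blockCorr_initialBlock (x y : ℕ → ℂ) (n : ℕ) :
    blockCorr (initialBlock x n) (initialBlock y n)
      = (1 / (n : ℂ)) * ∑ i ∈ Finset.range n, x i * conj (y i)
        - ((1 / (n : ℂ)) * ∑ i ∈ Finset.range n, x i)
          * ((1 / (n : ℂ)) * ∑ i ∈ Finset.range n, conj (y i)) := by
  simp only [blockCorr, initialBlock, Finset.sum_range]

theorem norm_average_le {h : ℕ → ℂ} {C : ℝ} (hC : 0 ≤ C) (hh : ∀ i, ‖h i‖ ≤ C) (n : ℕ) :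
    ‖(1 / (n : ℂ)) * ∑ i ∈ Finset.range n, h i‖ ≤ C := by
  have h1 := norm_sum_le_of_le (Finset.range n) fun i _ => hh i
  rw [Finset.sum_const, Finset.card_range, nsmul_eq_mul] at h1
  rw [norm_mul, norm_div, norm_one, Complex.norm_natCast]
  rcases Nat.eq_zero_or_pos n with rfl | hn
  · simpa using hC
  · have hn' : (0 : ℝ) < n := by exact_mod_cast hn
    rw [one_div, inv_mul_le_iff₀ hn']
    exact h1

theorem norm_blockCorr_le {x y : ℕ → ℂ} (hx : ∀ i, ‖x i‖ ≤ 1) (hy : ∀ i, ‖y i‖ ≤ 1) (n : ℕ) :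
    ‖blockCorr (initialBlock x n) (initialBlock y n)‖ ≤ 1 + 1 * 1 := by
  have hy' : ∀ i, ‖conj (y i)‖ ≤ 1 := fun i => by rw [RCLike.norm_conj]; exact hy i
  have hxy : ∀ i, ‖x i * conj (y i)‖ ≤ 1 := fun i => by
    rw [norm_mul]
    exact mul_le_one₀ (hx i) (norm_nonneg _) (hy' i)
  rw [blockCorr_initialBlock]
  refine (norm_sub_le _ _).trans (add_le_add (norm_average_le zero_le_one hxy n) ?_)
  rw [norm_mul]
  exact mul_le_mul (norm_average_le zero_le_one hx n) (norm_average_le zero_le_one hy' n)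
    (norm_nonneg _) zero_le_one

/-- The inequality liminf ≤ limsup in ℝ needs bounded sequences, hence the bounds on the symbols. -/
theorem StronglyCorrelated.weaklyCorrelated {x y : ℕ → ℂ} (hx : ∀ i, ‖x i‖ ≤ 1)
    (hy : ∀ i, ‖y i‖ ≤ 1) (h : StronglyCorrelated x y) : WeaklyCorrelated x y :=
  lt_of_lt_of_le h (liminf_le_limsup (isBoundedUnder_of ⟨_, norm_blockCorr_le hx hy⟩)
    (isBoundedUnder_of ⟨0, fun _ => norm_nonneg _⟩))

section

variable {K : Set ℂ}

theorem IsErgodicProb.isInvariantProb {X : Type*} [MeasurableSpace X] {T : X → X} {μ : Measure X}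
    (h : IsErgodicProb T μ) : IsInvariantProb T μ :=
  ⟨h.prob, h.ergodic.toMeasurePreserving⟩

theorem continuous_symbol (i : ℕ) : Continuous fun x : ℕ → K => (x i : ℂ) :=
  continuous_subtype_val.comp (continuous_apply i)

/-- If the orbit averages of a pair converge to the integrals of a measure `ξ`, then the
correlations of its initial blocks converge to the correlation determined by `ξ`. -/
theorem tendsto_blockCorr [Finite K] {l : Filter ℕ} {x y : ℕ → K} {μ ν : Measure (ℕ → K)}
    {ξ : Measure ((ℕ → K) × (ℕ → K))} (hfst : ξ.map Prod.fst = μ) (hsnd : ξ.map Prod.snd = ν)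
    (h : ∀ f : (ℕ → K) × (ℕ → K) → ℂ, Continuous f →
      Tendsto (fun n : ℕ => (1 / (n : ℂ)) *
        ∑ i ∈ Finset.range n, f ((Prod.map shift shift)^[i] (x, y))) l (𝓝 (∫ z, f z ∂ξ))) :
    Tendsto (fun n => blockCorr (initialBlock (fun n => (x n : ℂ)) n)
      (initialBlock (fun n => (y n : ℂ)) n)) l (𝓝 (joiningCorr μ ν ξ)) := by
  have : Countable K := Finite.to_countable
  have c1 : Continuous fun u : (ℕ → K) × (ℕ → K) => (u.1 0 : ℂ) :=
    (continuous_symbol 0).comp continuous_fst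
  have c2 : Continuous fun u : (ℕ → K) × (ℕ → K) => conj (u.2 0 : ℂ) :=
    Complex.continuous_conj.comp ((continuous_symbol 0).comp continuous_snd)
  have c3 : Continuous fun u : (ℕ → K) × (ℕ → K) => (u.1 0 : ℂ) * conj (u.2 0 : ℂ) := c1.mul c2
  have c4 : Continuous fun y : ℕ → K => conj (y 0 : ℂ) :=
    Complex.continuous_conj.comp (continuous_symbol 0)
  have h1 := (h _ c3).sub ((h _ c1).mul (h _ c2))
  have e1 : ∫ x, (x 0 : ℂ) ∂μ = ∫ u : (ℕ → K) × (ℕ → K), (u.1 0 : ℂ) ∂ξ := by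
    rw [← hfst, integral_map measurable_fst.aemeasurable
      (continuous_symbol 0).aestronglyMeasurable]
  have e2 : ∫ y, conj (y 0 : ℂ) ∂ν = ∫ u : (ℕ → K) × (ℕ → K), conj (u.2 0 : ℂ) ∂ξ := by
    rw [← hsnd, integral_map measurable_snd.aemeasurable c4.aestronglyMeasurable]
  rw [joiningCorr, e1, e2]
  simpa only [blockCorr_initialBlock, prodMap_shift_iterate, shift_iterate_apply, zero_add]
    using h1

/-- If every joining had correlation zero, the supremum would be zero. -/
theorem MeasuresCorrelated.exists_joining {μ ν : Measure (ℕ → K)} (h : MeasuresCorrelated μ ν) :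
    ∃ ξ, IsJoining μ ν ξ ∧ joiningCorr μ ν ξ ≠ 0 := by
  by_contra! hcon
  refine h (le_antisymm (Real.sSup_le ?_ le_rfl) (Real.sSup_nonneg ?_))
  · rintro r ⟨ξ, hξ, rfl⟩
    rw [hcon ξ hξ, norm_zero]
  · rintro r ⟨ξ, hξ, rfl⟩
    exact norm_nonneg _

theorem IsJoining.measuresCorrelated (hK : K ⊆ Metric.closedBall 0 1) {μ ν : Measure (ℕ → K)}
    (hμ : IsInvariantProb shift μ) (hν : IsInvariantProb shift ν)
    {ξ : Measure ((ℕ → K) × (ℕ → K))} (hξ : IsJoining μ ν ξ) (h : joiningCorr μ ν ξ ≠ 0) :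
    MeasuresCorrelated μ ν :=
  ((norm_pos_iff.2 h).trans_le (le_csSup (measureCorr_set_bddAbove hK hμ hν) ⟨ξ, hξ, rfl⟩)).ne'

/-- Points generic for correlated measures, the first one given, can be strongly correlated. -/
theorem MeasuresCorrelated.exists_stronglyCorrelated [Finite K] {μ ν : Measure (ℕ → K)}
    (h : MeasuresCorrelated μ ν) {x : ℕ → K} (hx : IsGeneric shift x μ) :
    ∃ y : ℕ → K, IsGeneric shift y ν ∧
      StronglyCorrelated (fun n => (x n : ℂ)) (fun n => (y n : ℂ)) := by
  have : Fintype K := Fintype.ofFinite K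
  have : Countable K := Finite.to_countable
  have : Nonempty K := ⟨x 0⟩
  obtain ⟨ξ, hξ, hne⟩ := h.exists_joining
  obtain ⟨y, hy⟩ := exists_isGeneric_lift ξ hξ.invariantProb (x := x) (by rwa [hξ.fst])
  refine ⟨y, fun f hf => ?_, ?_⟩
  · have h1 := hy (fun u => f u.2) (hf.comp continuous_snd)
    simp only [prodMap_shift_iterate] at h1
    rwa [← hξ.snd, integral_map measurable_snd.aemeasurable hf.aestronglyMeasurable]
  · have h1 := (tendsto_blockCorr hξ.fst hξ.snd fun f hf => hy.tendsto_range hf).norm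
    rw [StronglyCorrelated, h1.liminf_eq]
    exact norm_pos_iff.2 hne

/-- The limit of orbit averages of a pair of generic points is a joining. -/
theorem isJoining_of_tendsto [Finite K] {μ ν : Measure (ℕ → K)} [IsFiniteMeasure μ]
    [IsFiniteMeasure ν] {x y : ℕ → K} (hx : IsGeneric shift x μ) (hy : IsGeneric shift y ν)
    {U : Ultrafilter ℕ} (hU : (U : Filter ℕ) ≤ atTop) {ξ : Measure ((ℕ → K) × (ℕ → K))}
    [IsProbabilityMeasure ξ]
    (h : ∀ f : (ℕ → K) × (ℕ → K) → ℂ, Continuous f →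
      Tendsto (fun n : ℕ => (1 / (n : ℂ)) *
        ∑ i ∈ Finset.range n, f ((Prod.map shift shift)^[i] (x, y))) U (𝓝 (∫ z, f z ∂ξ))) :
    IsJoining μ ν ξ := by
  have : Countable K := Finite.to_countable
  have hT : Continuous (Prod.map shift shift : (ℕ → K) × (ℕ → K) → _) :=
    continuous_shift.prodMap continuous_shift
  refine ⟨⟨inferInstance, hT.measurable, ?_⟩, ?_, ?_⟩
  · have := Measure.isProbabilityMeasure_map (μ := ξ) hT.measurable.aemeasurable
    refine measure_eq_of_integral_continuous_eq fun f hf => ?_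
    rw [integral_map hT.measurable.aemeasurable hf.aestronglyMeasurable]
    exact integral_comp_eq_of_tendsto hT hU h hf
  · refine measure_eq_of_integral_continuous_eq fun f hf => ?_
    rw [integral_map measurable_fst.aemeasurable hf.aestronglyMeasurable]
    refine tendsto_nhds_unique (h _ (hf.comp continuous_fst)) ?_
    simpa only [prodMap_shift_iterate] using (hx.tendsto_range hf).mono_left hU
  · refine measure_eq_of_integral_continuous_eq fun f hf => ?_
    rw [integral_map measurable_snd.aemeasurable hf.aestronglyMeasurable]
    refine tendsto_nhds_unique (h _ (hf.comp continuous_snd)) ?_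
    simpa only [prodMap_shift_iterate] using (hy.tendsto_range hf).mono_left hU

/-- Passing to the limit along times where |c_n| > δ produces a joining whose correlation has
modulus at least δ. -/
theorem WeaklyCorrelated.measuresCorrelated [Finite K] (hK : K ⊆ Metric.closedBall 0 1)
    {μ ν : Measure (ℕ → K)} (hμ : IsInvariantProb shift μ) (hν : IsInvariantProb shift ν)
    {x y : ℕ → K} (hx : IsGeneric shift x μ) (hy : IsGeneric shift y ν)
    (h : WeaklyCorrelated (fun n => (x n : ℂ)) (fun n => (y n : ℂ))) :
    MeasuresCorrelated μ ν := by
  have : Countable K := Finite.to_countable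
  have := hμ.prob
  have := hν.prob
  obtain ⟨δ, hδ, hδ'⟩ := exists_between (show (0 : ℝ) < _ from h)
  have hfreq := frequently_lt_of_lt_limsup
    (isCoboundedUnder_le_of_le atTop (x := 0) fun _ => norm_nonneg _) hδ'
  let S : Set ℕ := {n | δ < ‖blockCorr (initialBlock (fun n => (x n : ℂ)) n)
    (initialBlock (fun n => (y n : ℂ)) n)‖}
  -- The set S is met arbitrarily late, so some ultrafilter is finer than `atTop` and contains S.
  have hne : (atTop ⊓ 𝓟 S).NeBot := frequently_mem_iff_neBot.1 hfreq
  have hU := Ultrafilter.of_le (atTop ⊓ 𝓟 S)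
  obtain ⟨ξ, hξ, hlim⟩ := exists_limit_measure (Prod.map shift shift) (x, y)
    (hU.trans inf_le_left)
  have hjoin := isJoining_of_tendsto hx hy (hU.trans inf_le_left) hlim
  refine hjoin.measuresCorrelated hK hμ hν (norm_pos_iff.1 (hδ.trans_le ?_))
  refine ge_of_tendsto (tendsto_blockCorr hjoin.fst hjoin.snd hlim).norm ?_
  filter_upwards [hU.trans inf_le_right (mem_principal_self _)] with n hn
  exact hn.le

end

end SeqCorr

theorem theorem2p5 (K : Set ℂ) (hfin : K.Finite) (hK : K ⊆ Metric.closedBall 0 1)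
    (μ : MeasureTheory.Measure (ℕ → K)) (hμ : SeqCorr.IsInvariantProb SeqCorr.shift μ)
    (x : ℕ → K) (hx : SeqCorr.IsGeneric SeqCorr.shift x μ) :
    List.TFAE [
      ∃ (ν : MeasureTheory.Measure (ℕ → K)) (y : ℕ → K),
        SeqCorr.IsErgodicProb SeqCorr.shift ν ∧ SeqCorr.IsGeneric SeqCorr.shift y ν ∧
          SeqCorr.WeaklyCorrelated (fun n => (x n : ℂ)) (fun n => (y n : ℂ)),
      ∃ (ν : MeasureTheory.Measure (ℕ → K)) (y : ℕ → K),
        SeqCorr.IsErgodicProb SeqCorr.shift ν ∧ SeqCorr.IsGeneric SeqCorr.shift y ν ∧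
          SeqCorr.StronglyCorrelated (fun n => (x n : ℂ)) (fun n => (y n : ℂ)),
      ∃ ν : MeasureTheory.Measure (ℕ → K),
        SeqCorr.IsErgodicProb SeqCorr.shift ν ∧ SeqCorr.MeasuresCorrelated μ ν] := by
  have : Finite K := hfin.to_subtype
  have hb : ∀ (y : ℕ → K) (i : ℕ), ‖(y i : ℂ)‖ ≤ 1 := fun y i => by simpa using hK (y i).2
  tfae_have 1 → 3 := by
    rintro ⟨ν, y, hν, hy, h⟩
    exact ⟨ν, hν, h.measuresCorrelated hK hμ hν.isInvariantProb hx hy⟩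
  tfae_have 3 → 2 := by
    rintro ⟨ν, hν, h⟩
    obtain ⟨y, hy, h'⟩ := h.exists_stronglyCorrelated hx
    exact ⟨ν, y, hν, hy, h'⟩
  tfae_have 2 → 1 := by
    rintro ⟨ν, y, hν, hy, h⟩
    exact ⟨ν, y, hν, hy, h.weaklyCorrelated (hb x) (hb y)⟩
  tfae_finish
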